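/- Let $0<\alpha<1$, and for $n\ge 1$ put $n_1=\lfloor n\alpha\rfloor$, $n_2=n-n_1$. For a vector $u\in\mathbb R^k$ write $\|u\|^2=\sum_{i=1}^k u_i^2$ and $\overline{u^2}=\|u\|^2/k$. For $\sigma_0^2>0$ and $\mu_0=(\mu_1^0,\dots,\mu_{n_2}^0)\in\mathbb R^{n_2}$ let $E_0^n$ be the expectation under which $Y=(Y_1,\dots,Y_{n_1})$ and $Z=(Z_1,\dots,Z_{n_2})$ have independent coordinates with $Y_i\sim\mathcal N(0,\sigma_0^2)$ and $Z_i\sim\mathcal N(\mu_i^0,\sigma_0^2)$. Let $\gamma,\pi:[0,\infty)\to(0,\infty)$ be positive, uniformly continuous probability densities with respect to Lebesgue measure. Let $\nu=\nu_{n_2}$ be the hierarchical Gaussian mixture prior on $\mathbb R^{n_2}$: $\theta^2\sim\gamma$ and, given $\theta^2$, the coordinates $\mu_i$ are independent with $\mu_i\mid\theta^2\sim\mathcal N(0,\theta^2)$. Independently of $\mu$, give $\sigma^2$ the prior density $\pi$. The marginal posterior $\Pi(\cdot\mid Y,Z)$ of $\sigma^2$ is the probability distribution on $(0,\infty)$ with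 density $$\pi(\sigma^2\mid Y,Z)\ \propto\ \sigma^{-n}e^{-\|Y\|^2/(2\sigma^2)}\Big(\int_{\mathbb R^{n_2}}e^{-\|Z-\mu\|^2/(2\sigma^2)}\,d\nu(\mu)\Big)\pi(\sigma^2).$$ With $\Phi$ the standard normal distribution function, let $\Pi_\infty(\cdot\mid Y,Z)$ and $\widetilde\Pi_\infty(\cdot\mid Y)$ be the probability distributions with densities $$\pi_\infty(\sigma^2\mid Y,Z)\propto \mathbf 1(\sigma^2\ge 0)\,e^{-\frac{n_1}{4\sigma_0^4}(\sigma^2-\overline{Y^2})^2}\Big[1-\Phi\Big(\frac{\sqrt{n_2}\,(\sigma^2-\overline{Z^2})}{\sqrt2\,(\sigma_0^2+\overline{\mu_0^2})}\Big)\Big],\qquad \widetilde\pi_\infty(\sigma^2\mid Y)\propto \mathbf 1(\sigma^2\ge 0)\,e^{-\frac{n_1}{4\sigma_0^4}(\sigma^2-\overline{Y^2})^2},$$ and let $\|P-Q\|_{\mathrm{TV}}=\sup_A|P(A)-Q(A)|$ over Borel sets $A$. Then for all compact sets $K\subset(0,\infty)$ and $K'\subset\mathbb R$, as $n\to\infty$,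 $$\sup_{\sigma_0^2\in K,\ \mu_i^0\in K'\ \forall i}\ E_0^n\Big[\big\|\Pi(\cdot\mid Y,Z)-\Pi_\infty(\cdot\mid Y,Z)\big\|_{\mathrm{TV}}\Big]\longrightarrow 0 .$$ Moreover, for every sequence $(r_n)$ of real numbers with $r_n/(\log n/n)^{1/4}\to\infty$, $$\sup_{\sigma_0^2\in K,\ \mu_i^0\in K',\ |\mu_i^0|\ge r_n\ \forall i}\ E_0^n\Big[\big\|\Pi(\cdot\mid Y,Z)-\widetilde\Pi_\infty(\cdot\mid Y)\big\|_{\mathrm{TV}}\Big]\longrightarrow 0$$ (a supremum over the empty set being $0$). -/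

import Mathlib

open MeasureTheory ProbabilityTheory Filter Topology
open scoped ENNReal

namespace PartialMeans

/-- The average of the squares `(u₁² + ⋯ + u_k²) / k` of a vector. -/
noncomputable def meanSq {k : ℕ} (u : Fin k → ℝ) : ℝ := (∑ i, u i ^ 2) / k

/-- The law of the data `(Y, Z)` in the Gaussian sequence model with partial information on the
means: all coordinates are independent, `Y_i ∼ N(0, s₀)` for the `n₁` observations with known mean
zero, `Z_i ∼ N(μ₀ i, s₀)` for the other `n₂` observations. Here `s₀ = σ₀²` is the variance. -/
noncomputable def dataLaw (n₁ n₂ : ℕ) (s₀ : ℝ) (μ₀ : Fin n₂ → ℝ) :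
    Measure ((Fin n₁ → ℝ) × (Fin n₂ → ℝ)) :=
  (Measure.pi fun _ : Fin n₁ => gaussianReal 0 s₀.toNNReal).prod
    (Measure.pi fun i : Fin n₂ => gaussianReal (μ₀ i) s₀.toNNReal)

/-- The hierarchical Gaussian mixture prior on the mean vector: `θ² = t` has Lebesgue density `γ`
on `[0, ∞)` and, given `t`, the means are independent with law `N(0, t)`. -/
noncomputable def mixturePrior (γ : ℝ → ℝ) (n₂ : ℕ) : Measure (Fin n₂ → ℝ) :=
  ((volume.restrict (Set.Ici (0 : ℝ))).withDensity fun t => ENNReal.ofReal (γ t)).bind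
    fun t => Measure.pi fun _ : Fin n₂ => gaussianReal 0 t.toNNReal

/-- The marginal likelihood of the variance `s = σ²` when the mean vector has prior `ν`:
`σ^{-n} exp(-‖Y‖²/(2σ²)) ∫ exp(-‖Z - μ‖²/(2σ²)) dν(μ)` with `n = n₁ + n₂`. -/
noncomputable def marginalLikelihood {n₁ n₂ : ℕ} (ν : Measure (Fin n₂ → ℝ))
    (Y : Fin n₁ → ℝ) (Z : Fin n₂ → ℝ) (s : ℝ) : ℝ≥0∞ :=
  ENNReal.ofReal ((√s ^ (n₁ + n₂))⁻¹ * Real.exp (-(∑ i, Y i ^ 2) / (2 * s))) *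
    ∫⁻ μ, ENNReal.ofReal (Real.exp (-(∑ i, (Z i - μ i) ^ 2) / (2 * s))) ∂ν

/-- The measure on `ℝ` whose Lebesgue density is proportional to `f`, normalised to total mass one
(meaningful when `f` is measurable and `0 < ∫ f < ∞`). -/
noncomputable def lawOfDensity (f : ℝ → ℝ≥0∞) : Measure ℝ :=
  (∫⁻ s, f s)⁻¹ • volume.withDensity f

/-- The marginal posterior distribution of the variance given by Bayes' formula, for the mean
vector `μ ∼ mixturePrior γ n₂` and, independently, `σ²` with Lebesgue density `π` on `[0, ∞)`. -/
noncomputable def posterior (γ π : ℝ → ℝ) {n₁ n₂ : ℕ} (Y : Fin n₁ → ℝ) (Z : Fin n₂ → ℝ) :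
    Measure ℝ :=
  lawOfDensity ((Set.Ioi (0 : ℝ)).indicator fun s =>
    marginalLikelihood (mixturePrior γ n₂) Y Z s * ENNReal.ofReal (π s))

/-- The non-Gaussian limit distribution, with density proportional to
`1(s ≥ 0) exp(-n₁ (s - meanSq Y)² / (4 σ₀⁴)) [1 - Φ(√n₂ (s - meanSq Z) / (√2 (σ₀² + meanSq μ₀)))]`,
where `s₀ = σ₀²` and `Φ` is the standard normal distribution function. -/
noncomputable def limitLaw {n₁ n₂ : ℕ} (s₀ : ℝ) (μ₀ : Fin n₂ → ℝ)
    (Y : Fin n₁ → ℝ) (Z : Fin n₂ → ℝ) : Measure ℝ :=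
  lawOfDensity ((Set.Ici (0 : ℝ)).indicator fun s =>
    ENNReal.ofReal (Real.exp (-(n₁ / (4 * s₀ ^ 2)) * (s - meanSq Y) ^ 2) *
      (1 - cdf (gaussianReal 0 1) (√n₂ * (s - meanSq Z) / (√2 * (s₀ + meanSq μ₀))))))

/-- The truncated Gaussian limit distribution, with density proportional to
`1(s ≥ 0) exp(-n₁ (s - meanSq Y)² / (4 σ₀⁴))`, where `s₀ = σ₀²`. -/
noncomputable def truncGaussianLaw {n₁ : ℕ} (s₀ : ℝ) (Y : Fin n₁ → ℝ) : Measure ℝ :=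
  lawOfDensity ((Set.Ici (0 : ℝ)).indicator fun s =>
    ENNReal.ofReal (Real.exp (-(n₁ / (4 * s₀ ^ 2)) * (s - meanSq Y) ^ 2)))

/-- The total variation distance `sup_A |P A - Q A|` of two probability measures on `ℝ`. -/
noncomputable def tvDist (P Q : Measure ℝ) : ℝ≥0∞ :=
  ⨆ (A : Set ℝ) (_ : MeasurableSet A), ENNReal.ofReal |P.real A - Q.real A|

end PartialMeans

/-!
The variance posterior is the first marginal of a planar density. Completing the square integrates
out the means given `θ² = t`, and the substitution `v = s + t` turns the mixture over `t` into an
integral over `v > s` (`posterior_eq_lawOfDensity`): with `a = meanSq Y`, `b = meanSq Z`,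
`φ u = u - 1 - log u` and sample sizes `k`, `l`, the posterior of `s = σ²` is the first marginal of
`1(0 < s < v) π(s) γ(v - s) exp(-(k/2) φ(a/s)) exp(-(l/2) φ(b/v))`.
Both limit laws are first marginals of the Gaussian kernel
`exp(-k (s - a)² / (4 s₀²)) exp(-l (v - b)² / (4 w²))`, `w = s₀ + meanSq μ₀`, restricted to
`0 ≤ s < v` and to `0 ≤ s` respectively, since `1 - Φ` is the integral of a Gaussian over `v > s`
(`limitLaw_eq_lawOfDensity`, `truncGaussianLaw_eq_lawOfDensity`).

By Chebyshev's inequality (`dataLaw_compl_le`), `a` and `b` are within `M / √n` of `s₀` and `w`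
with probability close to one, uniformly in the parameters. On such data the planar densities are
compared in `exists_radius_eventually_tvDist_le`. In a window of radius `R / √n` around `(a, b)`
their ratio is a constant up to a factor close to `1`, by a Taylor expansion of `φ` and the
continuity of `π` and `γ` (`abs_density_sub_le`). Outside it, the inequality
`φ(a/s) ≥ (s - a)² / (2 L²)` for `s ≤ L` gives Gaussian tails on bounded ranges, and elsewhere the
posterior density is at most `exp(-c n)` times the prior, whose total mass is one
(`jointDensity_le`). All errors are small compared with the mass of the limit density, which is at
least of order `1 / n` even when truncated to `s < v`, as `b - a` is not far below zero on the scale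
`1 / √n` (`ofReal_le_lintegral_gaussDensity`).

When all means exceed `r` in absolute value with `√n r² → ∞`, the peaks `a` and `b` are separated by
much more than `1 / √n`; hence `s < v` holds automatically in the window and the restriction may be
dropped.
-/

namespace PartialMeans

/-! ### Total variation between normalised densities -/

lemma lawOfDensity_apply (f : ℝ → ℝ≥0∞) {A : Set ℝ} (hA : MeasurableSet A) :
    lawOfDensity f A = (∫⁻ s, f s)⁻¹ * ∫⁻ s in A, f s := by
  simp [lawOfDensity, withDensity_apply _ hA]

lemma lawOfDensity_apply_le_one (f : ℝ → ℝ≥0∞) {A : Set ℝ} (hA : MeasurableSet A) :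
    lawOfDensity f A ≤ 1 := by
  rw [lawOfDensity_apply f hA]
  calc (∫⁻ s, f s)⁻¹ * ∫⁻ s in A, f s ≤ (∫⁻ s, f s)⁻¹ * ∫⁻ s, f s := by
        gcongr; exact Measure.restrict_le_self
    _ ≤ 1 := ENNReal.inv_mul_le_one _

lemma lawOfDensity_const_mul {κ : ℝ≥0∞} (h0 : κ ≠ 0) (h1 : κ ≠ ∞) (f : ℝ → ℝ≥0∞) :
    lawOfDensity (fun s => κ * f s) = lawOfDensity f := by
  ext A hA
  rw [lawOfDensity_apply _ hA, lawOfDensity_apply _ hA, lintegral_const_mul' _ _ h1,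
    lintegral_const_mul' _ _ h1, ENNReal.mul_inv (Or.inl h0) (Or.inl h1), mul_mul_mul_comm,
    ENNReal.inv_mul_cancel h0 h1, one_mul]

lemma tvDist_lawOfDensity_le_one (f g : ℝ → ℝ≥0∞) :
    tvDist (lawOfDensity f) (lawOfDensity g) ≤ 1 := by
  refine iSup₂_le fun A hA => ?_
  rw [← ENNReal.ofReal_one]
  apply ENNReal.ofReal_le_ofReal
  have hf : (lawOfDensity f).real A ≤ 1 :=
    ENNReal.toReal_le_of_le_ofReal zero_le_one (by simpa using lawOfDensity_apply_le_one f hA)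
  have hg : (lawOfDensity g).real A ≤ 1 :=
    ENNReal.toReal_le_of_le_ofReal zero_le_one (by simpa using lawOfDensity_apply_le_one g hA)
  have hf0 : 0 ≤ (lawOfDensity f).real A := measureReal_nonneg
  have hg0 : 0 ≤ (lawOfDensity g).real A := measureReal_nonneg
  rw [abs_le]; constructor <;> linarith

/-- If the unnormalised masses of every set differ by at most a fraction `η` of the total mass, then
the normalised laws differ by at most `2 η`. -/
lemma tvDist_lawOfDensity_le {f g : ℝ → ℝ≥0∞} {η : ℝ} (hη0 : 0 ≤ η)
    (hg0 : ∫⁻ s, g s ≠ 0) (hg1 : ∫⁻ s, g s ≠ ∞)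
    (h1 : ∀ A, MeasurableSet A →
      ∫⁻ s in A, f s ≤ (∫⁻ s in A, g s) + ENNReal.ofReal η * ∫⁻ s, g s)
    (h2 : ∀ A, MeasurableSet A →
      ∫⁻ s in A, g s ≤ (∫⁻ s in A, f s) + ENNReal.ofReal η * ∫⁻ s, g s) :
    tvDist (lawOfDensity f) (lawOfDensity g) ≤ ENNReal.ofReal (2 * η) := by
  rcases le_or_gt 1 η with hη | hη
  · refine (tvDist_lawOfDensity_le_one f g).trans ?_
    rw [← ENNReal.ofReal_one]; exact ENNReal.ofReal_le_ofReal (by linarith)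
  have hf1 : ∫⁻ s, f s ≠ ∞ := by
    have := h1 Set.univ MeasurableSet.univ
    simp only [Measure.restrict_univ] at this
    exact ne_top_of_le_ne_top (by finiteness) this
  have real_le {A : Set ℝ} {f : ℝ → ℝ≥0∞} (hf : ∫⁻ s, f s ≠ ∞) : ∫⁻ s in A, f s ≠ ∞ :=
    ne_top_of_le_ne_top hf (setLIntegral_le_lintegral _ _)
  have H1 : ∀ A, MeasurableSet A → |(∫⁻ s in A, f s).toReal - (∫⁻ s in A, g s).toReal| ≤
      η * (∫⁻ s, g s).toReal := by
    intro A hA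
    have e1 := ENNReal.toReal_mono (ENNReal.add_ne_top.2 ⟨real_le hg1, by finiteness⟩) (h1 A hA)
    have e2 := ENNReal.toReal_mono (ENNReal.add_ne_top.2 ⟨real_le hf1, by finiteness⟩) (h2 A hA)
    rw [ENNReal.toReal_add (real_le hg1) (by finiteness), ENNReal.toReal_mul,
      ENNReal.toReal_ofReal hη0] at e1
    rw [ENNReal.toReal_add (real_le hf1) (by finiteness), ENNReal.toReal_mul,
      ENNReal.toReal_ofReal hη0] at e2
    rw [abs_le]; constructor <;> linarith
  refine iSup₂_le fun A hA => ENNReal.ofReal_le_ofReal ?_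
  have hU := H1 Set.univ MeasurableSet.univ
  have hAA := H1 A hA
  simp only [Measure.restrict_univ] at hU
  simp only [Measure.real, lawOfDensity_apply _ hA, ENNReal.toReal_mul, ENNReal.toReal_inv]
  have hG : 0 < (∫⁻ s, g s).toReal := ENNReal.toReal_pos hg0 hg1
  have hle : (∫⁻ s in A, f s).toReal ≤ (∫⁻ s, f s).toReal :=
    ENNReal.toReal_mono hf1 (setLIntegral_le_lintegral _ _)
  have hfA : 0 ≤ (∫⁻ s in A, f s).toReal := ENNReal.toReal_nonneg
  generalize (∫⁻ s, g s).toReal = G at *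
  generalize (∫⁻ s, f s).toReal = F at *
  generalize (∫⁻ s in A, f s).toReal = x at *
  generalize (∫⁻ s in A, g s).toReal = y at *
  have hF : 0 < F := by
    have := (abs_le.1 hU).1
    nlinarith
  have e : F⁻¹ * x - G⁻¹ * y = (x - y) / G - (x / F) * ((F - G) / G) := by
    field_simp; ring
  have b1 : |(x - y) / G| ≤ η := by
    rw [abs_div, abs_of_pos hG, div_le_iff₀ hG]; exact hAA
  have b2 : |(F - G) / G| ≤ η := by
    rw [abs_div, abs_of_pos hG, div_le_iff₀ hG]; exact hU
  have b3 : |x / F| ≤ 1 := by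
    rw [abs_div, abs_of_pos hF, abs_of_nonneg hfA, div_le_one hF]; exact hle
  rw [e]
  calc _ ≤ |(x - y) / G| + |(x / F) * ((F - G) / G)| := abs_sub _ _
    _ ≤ η + 1 * η := by
        rw [abs_mul]
        gcongr
    _ = 2 * η := by ring

/-- Two normalised laws whose densities are first marginals of `F` and `H` are close in total
variation when `F` and `H` differ by at most `D` and the mass of `D` is a small fraction of the mass
of `H`. -/
lemma tvDist_marginal_le {F H D : ℝ → ℝ → ℝ≥0∞} 
    (hD : Measurable (Function.uncurry D)) {η : ℝ} (hη0 : 0 ≤ η)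
    (hH0 : ∫⁻ s, ∫⁻ v, H s v ≠ 0) (hH1 : ∫⁻ s, ∫⁻ v, H s v ≠ ∞)
    (h1 : ∀ s v, F s v ≤ H s v + D s v) (h2 : ∀ s v, H s v ≤ F s v + D s v)
    (hDH : ∫⁻ s, ∫⁻ v, D s v ≤ ENNReal.ofReal η * ∫⁻ s, ∫⁻ v, H s v) :
    tvDist (lawOfDensity fun s => ∫⁻ v, F s v) (lawOfDensity fun s => ∫⁻ v, H s v) ≤
      ENNReal.ofReal (2 * η) := by
  have key {f g : ℝ → ℝ → ℝ≥0∞} (h : ∀ s v, f s v ≤ g s v + D s v) (A : Set ℝ) :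
      ∫⁻ s in A, ∫⁻ v, f s v ≤
        (∫⁻ s in A, ∫⁻ v, g s v) + ENNReal.ofReal η * ∫⁻ s, ∫⁻ v, H s v := by
    calc ∫⁻ s in A, ∫⁻ v, f s v ≤ ∫⁻ s in A, ((∫⁻ v, g s v) + ∫⁻ v, D s v) := by
          refine lintegral_mono fun s => ?_
          rw [← lintegral_add_right _ (hD.of_uncurry_left (x := s))]
          exact lintegral_mono fun v => h s v
      _ = (∫⁻ s in A, ∫⁻ v, g s v) + ∫⁻ s in A, ∫⁻ v, D s v :=
          lintegral_add_right _ hD.lintegral_prod_right'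
      _ ≤ _ := by
          gcongr
          exact (setLIntegral_le_lintegral _ _).trans hDH
  exact tvDist_lawOfDensity_le hη0 hH0 hH1 (fun A _ => key h1 A) (fun A _ => key h2 A)

/-! ### The exponent of the inverse-gamma kernel -/

/-- The convex function `u ↦ u - 1 - log u`, minimal at `1`. Up to a factor not depending on `s`,
the kernel `s^{-k/2} exp(-k a / (2 s))` equals `exp(-(k/2) entropyGap (a / s))`. -/
noncomputable def entropyGap (u : ℝ) : ℝ := u - 1 - Real.log u

lemma hasDerivAt_entropyGap_div {a s : ℝ} (ha : 0 < a) (hs : 0 < s) :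
    HasDerivAt (fun x => entropyGap (a / x)) ((s - a) / s ^ 2) s := by
  have h : HasDerivAt (fun x : ℝ => a / x) (-a / s ^ 2) s := by
    refine ((hasDerivAt_const s a).div (hasDerivAt_id s) hs.ne').congr_deriv ?_
    simp
  have := (h.sub_const 1).sub (h.log (by positivity))
  refine this.congr_deriv ?_
  field_simp
  ring

lemma entropyGap_div_self {a : ℝ} (ha : 0 < a) : entropyGap (a / a) = 0 := by
  simp [entropyGap, div_self ha.ne']

/-- A quadratic lower bound on bounded ranges of `s`: the derivative `(s - a) / s²` of the exponent
is at least `(s - a) / L²` in absolute value. -/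
lemma sq_le_entropyGap_div {a s L : ℝ} (ha : 0 < a) (hs : 0 < s) (haL : a ≤ L) (hsL : s ≤ L) :
    (s - a) ^ 2 / (2 * L ^ 2) ≤ entropyGap (a / s) := by
  have hL : 0 < L := ha.trans_le haL
  set g : ℝ → ℝ := fun x => entropyGap (a / x) - (x - a) ^ 2 / (2 * L ^ 2) with hg
  have hd : ∀ x, 0 < x → HasDerivAt g ((x - a) / x ^ 2 - (x - a) / L ^ 2) x := by
    intro x hx
    refine (hasDerivAt_entropyGap_div ha hx).sub ?_
    have := (((hasDerivAt_id x).sub_const a).pow 2).div_const (2 * L ^ 2)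
    refine this.congr_deriv ?_
    simp; field_simp
  have hga : g a = 0 := by simp [hg, entropyGap_div_self ha]
  have hsq : ∀ x, 0 < x → x ≤ L → 1 / L ^ 2 ≤ 1 / x ^ 2 := by
    intro x hx hxL; gcongr
  have hsign : ∀ x, (x - a) / x ^ 2 - (x - a) / L ^ 2 = (x - a) * (1 / x ^ 2 - 1 / L ^ 2) := by
    intro x; ring
  suffices 0 ≤ g s by simp only [hg] at this; linarith
  rw [← hga]
  rcases le_total a s with h | h
  · have : MonotoneOn g (Set.Icc a s) := by
      refine monotoneOn_of_deriv_nonneg (convex_Icc a s)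
        (fun x hx => (hd x (ha.trans_le hx.1)).continuousAt.continuousWithinAt)
        (fun x hx => ?_) (fun x hx => ?_) <;> rw [interior_Icc] at hx
      · exact (hd x (ha.trans hx.1)).differentiableAt.differentiableWithinAt
      · rw [(hd x (ha.trans hx.1)).deriv, hsign]
        exact mul_nonneg (by linarith [hx.1])
          (by linarith [hsq x (ha.trans hx.1) (hx.2.le.trans hsL)])
    exact this ⟨le_rfl, h⟩ ⟨h, le_rfl⟩ h
  · have : AntitoneOn g (Set.Icc s a) := by
      refine antitoneOn_of_deriv_nonpos (convex_Icc s a)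
        (fun x hx => (hd x (hs.trans_le hx.1)).continuousAt.continuousWithinAt)
        (fun x hx => ?_) (fun x hx => ?_) <;> rw [interior_Icc] at hx
      · exact (hd x (hs.trans hx.1)).differentiableAt.differentiableWithinAt
      · rw [(hd x (hs.trans hx.1)).deriv, hsign]
        exact mul_nonpos_of_nonpos_of_nonneg (by linarith [hx.2])
          (by linarith [hsq x (hs.trans hx.1) (hx.2.le.trans haL)])
    exact this ⟨le_rfl, h⟩ ⟨h, le_rfl⟩ h

lemma entropyGap_div_nonneg {a s : ℝ} (ha : 0 < a) (hs : 0 < s) : 0 ≤ entropyGap (a / s) :=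
  le_trans (by positivity) (sq_le_entropyGap_div ha hs (le_max_left a s) (le_max_right a s))

lemma entropyGap_div_ge_of_two_mul_le {a s : ℝ} (ha : 0 < a) (h : 2 * a ≤ s) :
    1 / 8 ≤ entropyGap (a / s) := by
  have hs : 0 < s := by linarith
  refine le_trans ?_ (sq_le_entropyGap_div ha hs (by linarith) le_rfl)
  rw [div_le_div_iff₀ (by norm_num) (by positivity)]
  nlinarith

/-- The Taylor expansion of the exponent, with the variance `s₀` in place of the peak `a`. -/
lemma abs_entropyGap_div_sub_le {a s s₀ d κ : ℝ} (hκ : 0 < κ) (hs : κ ≤ s) (hs₀ : κ ≤ s₀)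
    (h1 : |s - a| ≤ d) (h2 : |s - s₀| ≤ d) (hd : 2 * d ≤ κ) :
    |entropyGap (a / s) - (s - a) ^ 2 / (2 * s₀ ^ 2)| ≤ 3 * d ^ 3 / κ ^ 3 := by
  have hs' : 0 < s := hκ.trans_le hs
  have hs₀' : 0 < s₀ := hκ.trans_le hs₀
  have hd0 : 0 ≤ d := (abs_nonneg _).trans h1
  set x := (s - a) / s with hx
  have hax : a / s = 1 - x := by rw [hx]; field_simp; ring
  have hxd : |x| ≤ d / κ := by
    rw [hx, abs_div, abs_of_pos hs']; gcongr
  have hx2 : |x| ≤ 1 / 2 := hxd.trans (by rw [div_le_div_iff₀ hκ (by norm_num)]; linarith)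
  have key := Real.abs_log_sub_add_sum_range_le (x := x) (by linarith) 2
  have key2 : |entropyGap (a / s) - x ^ 2 / 2| ≤ 2 * (d / κ) ^ 3 := by
    rw [entropyGap, hax]
    have e : 1 - x - 1 - Real.log (1 - x) - x ^ 2 / 2 =
        -(∑ i ∈ Finset.range 2, x ^ (i + 1) / (i + 1) + Real.log (1 - x)) := by
      simp [Finset.sum_range_succ]; ring
    rw [e, abs_neg]
    refine key.trans ?_
    rw [div_le_iff₀ (by linarith)]
    have : |x| ^ 3 ≤ (d / κ) ^ 3 := by gcongr
    have h3 : 0 ≤ (d / κ) ^ 3 := by positivity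
    norm_num
    nlinarith
  have key3 : |x ^ 2 / 2 - (s - a) ^ 2 / (2 * s₀ ^ 2)| ≤ (d / κ) ^ 3 := by
    have e : x ^ 2 / 2 - (s - a) ^ 2 / (2 * s₀ ^ 2) =
        (s - a) ^ 2 * (s₀ - s) * (1 / (s ^ 2 * s₀) + 1 / (s * s₀ ^ 2)) / 2 := by
      rw [hx]; field_simp; ring
    have b1 : 1 / (s ^ 2 * s₀) ≤ 1 / κ ^ 3 := by
      apply one_div_le_one_div_of_le (by positivity)
      calc κ ^ 3 = κ ^ 2 * κ := by ring
        _ ≤ _ := by gcongr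
    have b2 : 1 / (s * s₀ ^ 2) ≤ 1 / κ ^ 3 := by
      apply one_div_le_one_div_of_le (by positivity)
      calc κ ^ 3 = κ * κ ^ 2 := by ring
        _ ≤ _ := by gcongr
    rw [e, abs_div, abs_mul, abs_mul, abs_of_pos (by positivity : 0 < 1 / (s ^ 2 * s₀) + _),
      abs_pow, abs_sub_comm s₀ s, abs_two]
    calc _ ≤ d ^ 2 * d * (1 / κ ^ 3 + 1 / κ ^ 3) / 2 := by gcongr
      _ = (d / κ) ^ 3 := by field_simp; ring
  calc _ = |(entropyGap (a / s) - x ^ 2 / 2) + (x ^ 2 / 2 - (s - a) ^ 2 / (2 * s₀ ^ 2))| := by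
        congr 1; ring
    _ ≤ 2 * (d / κ) ^ 3 + (d / κ) ^ 3 := (abs_add_le _ _).trans (add_le_add key2 key3)
    _ = _ := by field_simp; ring

/-! ### Integrating out the means -/

/-- Completing the square: the Gaussian mixture of a Gaussian kernel is a Gaussian kernel. -/
lemma lintegral_exp_neg_sq_gaussianReal {s t : ℝ} (hs : 0 < s) (ht : 0 < t) (z : ℝ) :
    ∫⁻ μ, ENNReal.ofReal (Real.exp (-(z - μ) ^ 2 / (2 * s))) ∂(gaussianReal 0 t.toNNReal) =
      ENNReal.ofReal (√(s / (s + t)) * Real.exp (-z ^ 2 / (2 * (s + t)))) := by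
  have ht' : t.toNNReal ≠ 0 := by simpa using ht
  set w : ℝ := s * t / (s + t) with hw
  have hw0 : 0 < w := by positivity
  have hw' : w.toNNReal ≠ 0 := by simpa using hw0
  rw [gaussianReal_of_var_ne_zero _ ht', lintegral_withDensity_eq_lintegral_mul _ (by fun_prop)
    (by fun_prop)]
  have key : ∀ μ, (gaussianPDF 0 t.toNNReal * fun μ => ENNReal.ofReal
      (Real.exp (-(z - μ) ^ 2 / (2 * s)))) μ =
      ENNReal.ofReal (√(s / (s + t)) * Real.exp (-z ^ 2 / (2 * (s + t)))) *
        gaussianPDF (z * t / (s + t)) w.toNNReal μ := by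
    intro μ
    rw [Pi.mul_apply, gaussianPDF, gaussianPDF, ← ENNReal.ofReal_mul (gaussianPDFReal_nonneg _ _ _),
      ← ENNReal.ofReal_mul (by positivity)]
    congr 1
    rw [gaussianPDFReal, gaussianPDFReal, Real.coe_toNNReal _ ht.le, Real.coe_toNNReal _ hw0.le]
    have e1 : (√(2 * Real.pi * t))⁻¹ = √(s / (s + t)) * (√(2 * Real.pi * w))⁻¹ := by
      rw [← Real.sqrt_inv, ← Real.sqrt_inv, ← Real.sqrt_mul (by positivity)]
      congr 1
      rw [hw]; field_simp
    rw [e1, mul_assoc, mul_assoc, ← Real.exp_add, mul_mul_mul_comm, ← Real.exp_add, ← mul_assoc]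
    congr 2
    rw [hw]; field_simp; ring
  simp_rw [key]
  rw [lintegral_const_mul' _ _ ENNReal.ofReal_ne_top, lintegral_gaussianPDF_eq_one _ hw', mul_one]

lemma lintegral_exp_neg_sum_sq_pi {k : ℕ} {s t : ℝ} (hs : 0 < s) (ht : 0 < t) (z : Fin k → ℝ) :
    ∫⁻ μ, ENNReal.ofReal (Real.exp (-(∑ i, (z i - μ i) ^ 2) / (2 * s)))
        ∂(Measure.pi fun _ : Fin k => gaussianReal 0 t.toNNReal) =
      ENNReal.ofReal (√(s / (s + t)) ^ k * Real.exp (-(∑ i, z i ^ 2) / (2 * (s + t)))) := by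
  have e : ∀ μ : Fin k → ℝ, ENNReal.ofReal (Real.exp (-(∑ i, (z i - μ i) ^ 2) / (2 * s))) =
      ∏ i, ENNReal.ofReal (Real.exp (-(z i - μ i) ^ 2 / (2 * s))) := by
    intro μ
    rw [← ENNReal.ofReal_prod_of_nonneg (fun i _ => (Real.exp_pos _).le), ← Real.exp_sum,
      ← Finset.sum_div, Finset.sum_neg_distrib]
  simp_rw [e]
  have hind := iIndepFun_pi (μ := fun _ : Fin k => gaussianReal 0 t.toNNReal)
    (X := fun i x => ENNReal.ofReal (Real.exp (-(z i - x) ^ 2 / (2 * s))))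
    (fun i => by fun_prop)
  rw [lintegral_prod_eq_prod_lintegral_of_indepFun _ _ hind (fun i => by fun_prop)]
  have h1 : ∀ i, ∫⁻ μ : Fin k → ℝ, ENNReal.ofReal (Real.exp (-(z i - μ i) ^ 2 / (2 * s)))
      ∂(Measure.pi fun _ : Fin k => gaussianReal 0 t.toNNReal) =
      ENNReal.ofReal (√(s / (s + t)) * Real.exp (-z i ^ 2 / (2 * (s + t)))) := by
    intro i
    rw [← lintegral_exp_neg_sq_gaussianReal hs ht]
    exact (measurePreserving_eval (fun _ : Fin k => gaussianReal 0 t.toNNReal) i).lintegral_comp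
      (f := fun x => ENNReal.ofReal (Real.exp (-(z i - x) ^ 2 / (2 * s)))) (by fun_prop)
  simp_rw [h1]
  rw [← ENNReal.ofReal_prod_of_nonneg (fun i _ => by positivity), Finset.prod_mul_distrib,
    ← Real.exp_sum, ← Finset.sum_div, Finset.sum_neg_distrib]
  simp

lemma measurable_pi_gaussianReal (k : ℕ) :
    Measurable fun t : ℝ => Measure.pi fun _ : Fin k => gaussianReal 0 t.toNNReal := by
  -- The law is the image of the standard Gaussian under scaling by `√t`.
  have h : ∀ t : ℝ, (Measure.pi fun _ : Fin k => gaussianReal 0 t.toNNReal) =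
      (Measure.pi fun _ : Fin k => gaussianReal 0 1).map fun x i => √t * x i := by
    intro t
    rw [Measure.pi_map_pi (f := fun _ x => √t * x) (fun i => by fun_prop)]
    congr with i : 1
    rw [gaussianReal_map_const_mul]
    congr 1
    · simp
    · ext; simp [Real.sq_sqrt']
  simp_rw [h]
  refine Measure.measurable_of_measurable_coe _ fun A hA => ?_
  have : ∀ t : ℝ, ((Measure.pi fun _ : Fin k => gaussianReal 0 1).map fun x i => √t * x i) A =
      (Measure.pi fun _ : Fin k => gaussianReal 0 1)
        (Prod.mk t ⁻¹' {p : ℝ × (Fin k → ℝ) | (fun i => √p.1 * p.2 i) ∈ A}) := by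
    intro t
    rw [Measure.map_apply (by fun_prop) hA]; rfl
  simp_rw [this]
  refine measurable_measure_prodMk_left ?_
  exact measurableSet_preimage (by fun_prop) hA

lemma lintegral_mixturePrior {γ : ℝ → ℝ} (hγ : ContinuousOn γ (Set.Ici 0)) {k : ℕ}
    {s : ℝ} (hs : 0 < s) (z : Fin k → ℝ) :
    ∫⁻ μ, ENNReal.ofReal (Real.exp (-(∑ i, (z i - μ i) ^ 2) / (2 * s))) ∂(mixturePrior γ k) =
      ∫⁻ t in Set.Ioi 0, ENNReal.ofReal (γ t) *
        ENNReal.ofReal (√(s / (s + t)) ^ k * Real.exp (-(∑ i, z i ^ 2) / (2 * (s + t)))) := by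
  have hm := measurable_pi_gaussianReal k
  have hf : Measurable fun μ : Fin k → ℝ =>
    ENNReal.ofReal (Real.exp (-(∑ i, (z i - μ i) ^ 2) / (2 * s))) := by fun_prop
  have hg : Measurable fun t : ℝ => ∫⁻ μ,
      ENNReal.ofReal (Real.exp (-(∑ i, (z i - μ i) ^ 2) / (2 * s)))
        ∂(Measure.pi fun _ : Fin k => gaussianReal 0 t.toNNReal) :=
    (Measure.measurable_lintegral hf).comp hm
  rw [mixturePrior, Measure.lintegral_bind hm.aemeasurable hf.aemeasurable,
    lintegral_withDensity_eq_lintegral_mul₀ (hγ.aemeasurable measurableSet_Ici).ennreal_ofReal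
      hg.aemeasurable,
    restrict_Ioi_eq_restrict_Ici.symm]
  refine setLIntegral_congr_fun measurableSet_Ioi fun t ht => ?_
  simp only [Pi.mul_apply]
  rw [lintegral_exp_neg_sum_sq_pi hs ht]

/-! ### The posterior as a marginal of a planar density -/

/-- The joint density of `(s, v) = (σ², σ² + θ²)` given data with mean squares `a` and `b`, up to a
constant factor. -/
noncomputable def jointDensity (γ π : ℝ → ℝ) (k l : ℕ) (a b s v : ℝ) : ℝ≥0∞ :=
  {p : ℝ × ℝ | 0 < p.1 ∧ p.1 < p.2}.indicator
    (fun p => ENNReal.ofReal (π p.1 * γ (p.2 - p.1) *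
      Real.exp (-(k / 2 * entropyGap (a / p.1) + l / 2 * entropyGap (b / p.2))))) (s, v)

lemma sqrt_pow_inv_mul_exp {a s : ℝ} (ha : 0 < a) (hs : 0 < s) (k : ℕ) :
    (√s ^ k)⁻¹ * Real.exp (-(k * a) / (2 * s)) =
      Real.exp (-(k / 2 * (1 + Real.log a))) * Real.exp (-(k / 2 * entropyGap (a / s))) := by
  have h : √s = Real.exp (Real.log s / 2) := by
    rw [Real.exp_half, Real.exp_log hs]
  rw [h, ← Real.exp_nat_mul, ← Real.exp_neg, ← Real.exp_add, ← Real.exp_add, entropyGap,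
    Real.log_div ha.ne' hs.ne']
  congr 1
  field_simp
  ring

lemma sum_sq_eq_meanSq {k : ℕ} (u : Fin k → ℝ) : ∑ i, u i ^ 2 = k * meanSq u := by
  rcases Nat.eq_zero_or_pos k with rfl | hk
  · simp
  · rw [meanSq]; field_simp

/-- The substitution `v = s + θ²` turns the posterior of the variance into the first marginal of a
density on the half plane `s < v` in which the data enter through separate factors. -/
lemma posterior_eq_lawOfDensity {γ π : ℝ → ℝ} (hγ : ContinuousOn γ (Set.Ici 0))
    (hγ_pos : ∀ x, 0 ≤ x → 0 < γ x)
    {k l : ℕ} (Y : Fin k → ℝ) (Z : Fin l → ℝ) (ha : 0 < meanSq Y) (hb : 0 < meanSq Z) :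
    posterior γ π Y Z =
      lawOfDensity fun s => ∫⁻ v, jointDensity γ π k l (meanSq Y) (meanSq Z) s v := by
  set a := meanSq Y
  set b := meanSq Z
  -- The factor which normalises both kernels to have maximum `1`.
  set κ : ℝ := Real.exp (-(k / 2 * (1 + Real.log a))) * Real.exp (-(l / 2 * (1 + Real.log b)))
    with hκ
  have hκ0 : 0 < κ := by positivity
  rw [← lawOfDensity_const_mul (κ := ENNReal.ofReal κ) (by simpa using hκ0) ENNReal.ofReal_ne_top,
    posterior]
  congr 1
  ext s
  rcases le_or_gt s 0 with hs | hs
  · have : ∀ v, jointDensity γ π k l a b s v = 0 := fun v =>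
      Set.indicator_of_notMem (fun h => absurd h.1 (not_lt.2 hs)) _
    rw [Set.indicator_of_notMem (by simpa using hs)]
    simp [this]
  rw [Set.indicator_of_mem (by simpa using hs), marginalLikelihood, lintegral_mixturePrior hγ hs,
    sum_sq_eq_meanSq, ← lintegral_const_mul' _ _ ENNReal.ofReal_ne_top,
    ← lintegral_const_mul' _ _ ENNReal.ofReal_ne_top,
    ← lintegral_mul_const' _ _ ENNReal.ofReal_ne_top, ← lintegral_indicator measurableSet_Ioi,
    ← lintegral_sub_right_eq_self _ s]
  refine lintegral_congr fun v => ?_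
  rcases le_or_gt v s with hv | hv
  · rw [Set.indicator_of_notMem (by simpa using hv), jointDensity,
      Set.indicator_of_notMem (fun h => absurd h.2 (not_lt.2 hv)), mul_zero]
  have hv0 : 0 < v := hs.trans hv
  rw [Set.indicator_of_mem (by simpa using hv), jointDensity,
    Set.indicator_of_mem (show (s, v) ∈ {p : ℝ × ℝ | 0 < p.1 ∧ p.1 < p.2} from ⟨hs, hv⟩),
    sum_sq_eq_meanSq Z,
    ← ENNReal.ofReal_mul hκ0.le, ← ENNReal.ofReal_mul (hγ_pos _ (by linarith)).le,
    ← ENNReal.ofReal_mul (by positivity), ← ENNReal.ofReal_mul ?_]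
  swap
  · exact mul_nonneg (by positivity) (mul_nonneg (hγ_pos _ (by linarith)).le (by positivity))
  congr 1
  have e1 := sqrt_pow_inv_mul_exp ha hs k
  have e2 := sqrt_pow_inv_mul_exp hb hv0 l
  have e3 : (√s ^ (k + l))⁻¹ * √(s / v) ^ l = (√s ^ k)⁻¹ * (√v ^ l)⁻¹ := by
    rw [Real.sqrt_div hs.le, div_pow, pow_add]
    have := Real.sqrt_pos.2 hs
    have := Real.sqrt_pos.2 hv0
    field_simp
  rw [add_sub_cancel, neg_add, Real.exp_add]
  change _ * Real.exp (-(k * a) / (2 * s)) *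
    (γ (v - s) * (_ * Real.exp (-(l * b) / (2 * v)))) * _ = _
  calc _ = π s * γ (v - s) * ((√s ^ (k + l))⁻¹ * √(s / v) ^ l) *
        Real.exp (-(k * a) / (2 * s)) * Real.exp (-(l * b) / (2 * v)) := by ring
    _ = π s * γ (v - s) * ((√s ^ k)⁻¹ * Real.exp (-(k * a) / (2 * s))) *
        ((√v ^ l)⁻¹ * Real.exp (-(l * b) / (2 * v))) := by rw [e3]; ring
    _ = _ := by rw [e1, e2, hκ]; ring

/-! ### The limit laws as marginals of planar Gaussian densities -/

lemma lintegral_exp_neg_mul_sub_sq {c : ℝ} (hc : 0 < c) (b : ℝ) :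
    ∫⁻ x, ENNReal.ofReal (Real.exp (-(c * (x - b) ^ 2))) = ENNReal.ofReal √(Real.pi / c) := by
  rw [lintegral_sub_right_eq_self (fun x => ENNReal.ofReal (Real.exp (-(c * x ^ 2)))) b,
    ← integral_gaussian c, ofReal_integral_eq_lintegral_ofReal (integrable_exp_neg_mul_sq hc)
      (ae_of_all _ fun x => (Real.exp_pos _).le)]
  simp_rw [neg_mul]

/-- The Gaussian kernel in `(s, v)` with peak `(a, b)` and variances `2 s₀² / k` and `2 w² / l`,
restricted to `T`. -/
noncomputable def gaussDensity (T : Set (ℝ × ℝ)) (k l : ℕ) (s₀ w a b s v : ℝ) : ℝ≥0∞ :=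
  T.indicator (fun p => ENNReal.ofReal (Real.exp
    (-(k / (4 * s₀ ^ 2) * (p.1 - a) ^ 2 + l / (4 * w ^ 2) * (p.2 - b) ^ 2)))) (s, v)

lemma measurable_gaussDensity {T : Set (ℝ × ℝ)} (hT : MeasurableSet T) (k l : ℕ)
    (s₀ w a b : ℝ) : Measurable (Function.uncurry (gaussDensity T k l s₀ w a b)) := by
  have : Function.uncurry (gaussDensity T k l s₀ w a b) =
      T.indicator fun p => ENNReal.ofReal (Real.exp
        (-(k / (4 * s₀ ^ 2) * (p.1 - a) ^ 2 + l / (4 * w ^ 2) * (p.2 - b) ^ 2))) := by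
    ext ⟨s, v⟩; rfl
  rw [this]
  exact Measurable.indicator (by fun_prop) hT

lemma truncGaussianLaw_eq_lawOfDensity {k l : ℕ} (hl : 0 < l) {s₀ w : ℝ} (hw : 0 < w)
    (Y : Fin k → ℝ) (b : ℝ) :
    truncGaussianLaw s₀ Y =
      lawOfDensity fun s => ∫⁻ v, gaussDensity {p | 0 ≤ p.1} k l s₀ w (meanSq Y) b s v := by
  have hc : (0 : ℝ) < l / (4 * w ^ 2) := by positivity
  rw [truncGaussianLaw, ← lawOfDensity_const_mul
    (κ := ENNReal.ofReal √(Real.pi / (l / (4 * w ^ 2)))) (by simp; positivity)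
    ENNReal.ofReal_ne_top]
  congr 1
  ext s
  rcases lt_or_ge s 0 with hs | hs
  · have h : ∀ v, gaussDensity {p | 0 ≤ p.1} k l s₀ w (meanSq Y) b s v = 0 := by
      intro v
      rw [gaussDensity]
      exact Set.indicator_of_notMem (by simpa using hs) _
    rw [Set.indicator_of_notMem (by simpa using hs)]
    simp [h]
  · have h : ∀ v, gaussDensity {p | 0 ≤ p.1} k l s₀ w (meanSq Y) b s v =
        ENNReal.ofReal (Real.exp (-(k / (4 * s₀ ^ 2)) * (s - meanSq Y) ^ 2)) *
          ENNReal.ofReal (Real.exp (-(l / (4 * w ^ 2) * (v - b) ^ 2))) := by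
      intro v
      rw [gaussDensity, Set.indicator_of_mem (show (s, v) ∈ {p : ℝ × ℝ | 0 ≤ p.1} from hs),
        ← ENNReal.ofReal_mul (Real.exp_pos _).le, ← Real.exp_add, neg_add, neg_mul]
    simp_rw [h]
    rw [Set.indicator_of_mem (by simpa using hs), lintegral_const_mul' _ _ ENNReal.ofReal_ne_top,
      lintegral_exp_neg_mul_sub_sq hc, mul_comm]

/-- The Gaussian tail function as an integral of the unnormalised kernel. -/
lemma ofReal_one_sub_cdf_gaussianReal {l : ℕ} (hl : 0 < l) {w : ℝ} (hw : 0 < w) (b s : ℝ) :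
    ENNReal.ofReal √(Real.pi / (l / (4 * w ^ 2))) *
        ENNReal.ofReal (1 - cdf (gaussianReal 0 1) (√l * (s - b) / (√2 * w))) =
      ∫⁻ v in Set.Ioi s, ENNReal.ofReal (Real.exp (-(l / (4 * w ^ 2) * (v - b) ^ 2))) := by
  have hl' : (0 : ℝ) < l := by exact_mod_cast hl
  set σ : ℝ := √2 * w / √l with hσ
  have hσ0 : 0 < σ := by positivity
  have hσ2 : σ ^ 2 = 2 * w ^ 2 / l := by
    rw [hσ, div_pow, mul_pow, Real.sq_sqrt (by norm_num), Real.sq_sqrt hl'.le]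
  have hv : (σ ^ 2).toNNReal ≠ 0 := by simpa using hσ0.ne'
  have e1 : ENNReal.ofReal (1 - cdf (gaussianReal 0 1) (√l * (s - b) / (√2 * w))) =
      gaussianReal b (σ ^ 2).toNNReal (Set.Ioi s) := by
    have hmap : gaussianReal b (σ ^ 2).toNNReal =
        (gaussianReal 0 1).map (fun x => σ * x + b) := by
      have h1 : (fun x => σ * x + b) = (fun x => x + b) ∘ fun x => σ * x := rfl
      rw [h1, ← Measure.map_map (by fun_prop) (by fun_prop), gaussianReal_map_const_mul,
        gaussianReal_map_add_const]
      congr 1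
      · simp
      · ext; simp [Real.coe_toNNReal _ (sq_nonneg σ)]
    have hpre : (fun x => σ * x + b) ⁻¹' Set.Ioi s = (Set.Iic (√l * (s - b) / (√2 * w)))ᶜ := by
      ext x
      have : √l * (s - b) / (√2 * w) = (s - b) / σ := by rw [hσ]; field_simp
      simp only [Set.mem_preimage, Set.mem_Ioi, Set.mem_compl_iff, Set.mem_Iic, not_le, this,
        div_lt_iff₀ hσ0]
      constructor <;> intro h <;> linarith
    rw [hmap, Measure.map_apply (by fun_prop) measurableSet_Ioi, hpre, cdf_eq_real,
      ← probReal_compl_eq_one_sub measurableSet_Iic, ofReal_measureReal]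
  rw [e1, gaussianReal_apply _ hv, ← lintegral_const_mul' _ _ ENNReal.ofReal_ne_top]
  refine lintegral_congr fun v => ?_
  rw [gaussianPDF, ← ENNReal.ofReal_mul (by positivity), gaussianPDFReal,
    Real.coe_toNNReal _ (sq_nonneg σ), hσ2]
  have e2 : Real.pi / (l / (4 * w ^ 2)) = 2 * Real.pi * (2 * w ^ 2 / l) := by field_simp; ring
  rw [e2, ← mul_assoc, mul_inv_cancel₀ (by positivity), one_mul]
  congr 2
  field_simp
  ring

lemma limitLaw_eq_lawOfDensity {k l : ℕ} (hl : 0 < l) {s₀ : ℝ} (μ₀ : Fin l → ℝ)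
    (hw : 0 < s₀ + meanSq μ₀) (Y : Fin k → ℝ) (Z : Fin l → ℝ) :
    limitLaw s₀ μ₀ Y Z = lawOfDensity fun s => ∫⁻ v,
      gaussDensity {p | 0 ≤ p.1 ∧ p.1 < p.2} k l s₀ (s₀ + meanSq μ₀) (meanSq Y) (meanSq Z) s v := by
  set w := s₀ + meanSq μ₀ with hw'
  have hc : (0 : ℝ) < l / (4 * w ^ 2) := by positivity
  rw [limitLaw, ← lawOfDensity_const_mul
    (κ := ENNReal.ofReal √(Real.pi / (l / (4 * w ^ 2)))) (by simp; positivity)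
    ENNReal.ofReal_ne_top]
  congr 1
  ext s
  rcases lt_or_ge s 0 with hs | hs
  · have h : ∀ v, gaussDensity {p | 0 ≤ p.1 ∧ p.1 < p.2} k l s₀ w (meanSq Y) (meanSq Z) s v = 0 :=
      fun v => Set.indicator_of_notMem (fun h => absurd h.1 (not_le.2 hs)) _
    rw [Set.indicator_of_notMem (by simpa using hs)]
    simp [h]
  · have h : ∀ v, gaussDensity {p | 0 ≤ p.1 ∧ p.1 < p.2} k l s₀ w (meanSq Y) (meanSq Z) s v =
        ENNReal.ofReal (Real.exp (-(k / (4 * s₀ ^ 2)) * (s - meanSq Y) ^ 2)) *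
          (Set.Ioi s).indicator (fun v =>
            ENNReal.ofReal (Real.exp (-(l / (4 * w ^ 2) * (v - meanSq Z) ^ 2)))) v := by
      intro v
      rcases le_or_gt v s with hv | hv
      · rw [gaussDensity, Set.indicator_of_notMem (fun h => absurd h.2 (not_lt.2 hv)),
          Set.indicator_of_notMem (by simpa using hv), mul_zero]
      · rw [gaussDensity,
          Set.indicator_of_mem (show (s, v) ∈ {p : ℝ × ℝ | 0 ≤ p.1 ∧ p.1 < p.2} from ⟨hs, hv⟩),
          Set.indicator_of_mem (by simpa using hv),
          ← ENNReal.ofReal_mul (Real.exp_pos _).le, ← Real.exp_add, neg_add, neg_mul]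
    simp_rw [h]
    rw [Set.indicator_of_mem (by simpa using hs), lintegral_const_mul' _ _ ENNReal.ofReal_ne_top,
      lintegral_indicator measurableSet_Ioi, ← ofReal_one_sub_cdf_gaussianReal hl hw,
      ENNReal.ofReal_mul (Real.exp_pos _).le]
    ring

/-! ### Concentration of the mean squares -/

lemma memLp_sq_gaussianReal (m : ℝ) (v : NNReal) : MemLp (fun x => x ^ 2) 2 (gaussianReal m v) := by
  have h4 : MemLp (id : ℝ → ℝ) 4 (gaussianReal m v) := memLp_id_gaussianReal 4
  rw [memLp_two_iff_integrable_sq (by fun_prop)]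
  have := h4.integrable_norm_pow (p := 4) (by norm_num)
  refine this.congr (ae_of_all _ fun x => ?_)
  simp only [id, Real.norm_eq_abs]
  rw [← pow_mul, Even.pow_abs (by decide)]

lemma integral_sq_gaussianReal (m : ℝ) (v : NNReal) :
    ∫ x, x ^ 2 ∂(gaussianReal m v) = v + m ^ 2 := by
  have h := variance_eq_sub (memLp_id_gaussianReal (μ := m) (v := v) 2)
  have e : (gaussianReal m v)[id] = m := integral_id_gaussianReal
  rw [variance_id_gaussianReal, e] at h
  simp only [Pi.pow_apply, id] at h
  linarith

/-- The variance of the square of a Gaussian variable is bounded on bounded parameter sets. -/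
lemma exists_variance_sq_gaussianReal_le (L : ℝ) :
    ∃ C, 0 ≤ C ∧ ∀ (m : ℝ) (v : NNReal), |m| ≤ L → (v : ℝ) ≤ L →
      Var[fun x => x ^ 2; gaussianReal m v] ≤ C := by
  have hint (m : ℝ) (v : NNReal) : Integrable (fun x => x ^ 4) (gaussianReal m v) := by
    have := (memLp_two_iff_integrable_sq (by fun_prop)).1 (memLp_sq_gaussianReal m v)
    simpa only [← pow_mul] using this
  set c := ∫ x, x ^ 4 ∂(gaussianReal 0 1) with hc
  have hc0 : 0 ≤ c := integral_nonneg fun x => by positivity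
  refine ⟨8 * (L ^ 2 * c + L ^ 4), by positivity, fun m v hm hv => ?_⟩
  have hL : 0 ≤ L := (abs_nonneg m).trans hm
  have hmap : gaussianReal m v = (gaussianReal 0 1).map (fun x => √v * x + m) := by
    have h1 : (fun x => √v * x + m) = (fun x => x + m) ∘ fun x => √(v : ℝ) * x := rfl
    rw [h1, ← Measure.map_map (by fun_prop) (by fun_prop), gaussianReal_map_const_mul,
      gaussianReal_map_add_const]
    congr 1
    · simp
    · ext; simp
  calc Var[fun x => x ^ 2; gaussianReal m v]
      ≤ (gaussianReal m v)[(fun x : ℝ => x ^ 2) ^ 2] :=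
        variance_le_expectation_sq (by fun_prop)
    _ = ∫ x, x ^ 4 ∂(gaussianReal m v) := by
        congr 1; ext x; simp [← pow_mul]
    _ = ∫ x, (√v * x + m) ^ 4 ∂(gaussianReal 0 1) := by
        rw [hmap, integral_map (by fun_prop) (by fun_prop)]
    _ ≤ ∫ x, 8 * (L ^ 2 * x ^ 4 + L ^ 4) ∂(gaussianReal 0 1) := by
        refine integral_mono_of_nonneg (ae_of_all _ fun x => by positivity)
          ((((hint 0 1).const_mul _).add (integrable_const _)).const_mul _)
          (ae_of_all _ fun x => ?_)
        have h4 : (√v * x) ^ 4 = (v : ℝ) ^ 2 * x ^ 4 := by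
          rw [mul_pow]; congr 1
          rw [show (4 : ℕ) = 2 * 2 from rfl, pow_mul, Real.sq_sqrt v.coe_nonneg]
        have hm4 : m ^ 4 ≤ L ^ 4 := by
          rw [← Even.pow_abs (by decide : Even 4) m]; gcongr
        have hv2 : (v : ℝ) ^ 2 * x ^ 4 ≤ L ^ 2 * x ^ 4 := by gcongr
        have : (√v * x + m) ^ 4 ≤ 8 * ((√v * x) ^ 4 + m ^ 4) := by
          generalize √(v : ℝ) * x = y
          nlinarith [sq_nonneg (y - m), sq_nonneg (y + m), sq_nonneg (y ^ 2 - m ^ 2),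
            sq_nonneg ((y - m) ^ 2), mul_nonneg (sq_nonneg (y - m)) (sq_nonneg (y + m)),
            mul_nonneg (sq_nonneg (y - m)) (sq_nonneg y),
            mul_nonneg (sq_nonneg (y - m)) (sq_nonneg m)]
        rw [h4] at this
        linarith
    _ = 8 * (L ^ 2 * c + L ^ 4) := by
        rw [integral_const_mul, integral_add ((hint 0 1).const_mul _) (integrable_const _),
          integral_const_mul, ← hc]
        simp

lemma measurable_meanSq (k : ℕ) : Measurable (meanSq : (Fin k → ℝ) → ℝ) := by
  unfold meanSq; fun_prop

/-- Chebyshev's inequality for the mean square of independent Gaussian variables. -/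
lemma pi_gaussianReal_meanSq_le {C : ℝ} {k : ℕ} (hk : 0 < k) (m : Fin k → ℝ) (v : NNReal)
    (hC : ∀ i, Var[fun x => x ^ 2; gaussianReal (m i) v] ≤ C) {δ : ℝ} (hδ : 0 < δ) :
    (Measure.pi fun i => gaussianReal (m i) v) {u | δ ≤ |meanSq u - (v + meanSq m)|} ≤
      ENNReal.ofReal (C / (k * δ ^ 2)) := by
  have hk' : (0 : ℝ) < k := by exact_mod_cast hk
  set P := Measure.pi fun i => gaussianReal (m i) v
  have hcomp (i : Fin k) : MemLp (fun u : Fin k → ℝ => u i ^ 2) 2 P :=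
    (memLp_sq_gaussianReal (m i) v).comp_measurePreserving
      (measurePreserving_eval (fun i => gaussianReal (m i) v) i)
  have hmem : MemLp (meanSq : (Fin k → ℝ) → ℝ) 2 P := by
    have : (meanSq : (Fin k → ℝ) → ℝ) = fun u => (k : ℝ)⁻¹ * ∑ i, u i ^ 2 := by
      ext u; rw [meanSq]; ring
    rw [this]
    exact (memLp_finsetSum _ fun i _ => hcomp i).const_mul _
  have hmean : P[meanSq] = v + meanSq m := by
    simp only [meanSq]
    rw [integral_div, integral_finsetSum _ fun i _ => (hcomp i).integrable (by norm_num)]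
    have : ∀ i, ∫ u, u i ^ 2 ∂P = v + m i ^ 2 := by
      intro i
      rw [← integral_sq_gaussianReal]
      exact integral_comp_eval (μ := fun i => gaussianReal (m i) v) (i := i)
        (f := fun x => x ^ 2) (by fun_prop)
    simp_rw [this, Finset.sum_add_distrib]
    simp; field_simp
  have hvar : Var[meanSq; P] ≤ C / k := by
    have e : (meanSq : (Fin k → ℝ) → ℝ) =
        fun u => (k : ℝ)⁻¹ * (∑ i, fun u : Fin k → ℝ => u i ^ 2) u := by
      ext u; rw [meanSq, Finset.sum_apply]; ring
    rw [e, variance_const_mul,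
      variance_sum_pi (X := fun _ x => x ^ 2) fun i => memLp_sq_gaussianReal (m i) v]
    calc ((k : ℝ)⁻¹) ^ 2 * ∑ i, Var[fun x => x ^ 2; gaussianReal (m i) v]
        ≤ ((k : ℝ)⁻¹) ^ 2 * ∑ _i : Fin k, C := by gcongr with i; exact hC i
      _ = C / k := by simp; field_simp
  have := meas_ge_le_variance_div_sq hmem hδ
  rw [hmean] at this
  refine this.trans (ENNReal.ofReal_le_ofReal ?_)
  rw [← div_div]
  gcongr

/-- The data law gives small mass to the event that a mean square is far from its expectation. -/
lemma dataLaw_compl_le {C : ℝ} {k l : ℕ} (hk : 0 < k) (hl : 0 < l) {s₀ : ℝ} (hs₀ : 0 ≤ s₀)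
    (μ₀ : Fin l → ℝ) (hC : Var[fun x => x ^ 2; gaussianReal 0 s₀.toNNReal] ≤ C)
    (hC' : ∀ i, Var[fun x => x ^ 2; gaussianReal (μ₀ i) s₀.toNNReal] ≤ C) {δ : ℝ} (hδ : 0 < δ) :
    dataLaw k l s₀ μ₀
        {x | |meanSq x.1 - s₀| ≤ δ ∧ |meanSq x.2 - (s₀ + meanSq μ₀)| ≤ δ}ᶜ ≤
      ENNReal.ofReal (C / (k * δ ^ 2)) + ENNReal.ofReal (C / (l * δ ^ 2)) := by
  have h1 := pi_gaussianReal_meanSq_le hk (fun _ => 0) s₀.toNNReal (fun _ => hC) hδ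
  have h2 := pi_gaussianReal_meanSq_le hl μ₀ s₀.toNNReal hC' hδ
  have h0 : meanSq (fun _ : Fin k => (0 : ℝ)) = 0 := by simp [meanSq]
  rw [Real.coe_toNNReal _ hs₀] at h1 h2
  rw [h0, add_zero] at h1
  set A := {u : Fin k → ℝ | δ ≤ |meanSq u - s₀|} with hA
  set B := {u : Fin l → ℝ | δ ≤ |meanSq u - (s₀ + meanSq μ₀)|} with hB
  have hsub : {x : (Fin k → ℝ) × (Fin l → ℝ) |
      |meanSq x.1 - s₀| ≤ δ ∧ |meanSq x.2 - (s₀ + meanSq μ₀)| ≤ δ}ᶜ ⊆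
      A ×ˢ Set.univ ∪ Set.univ ×ˢ B := by
    rintro ⟨y, z⟩ h
    simp only [Set.mem_compl_iff, Set.mem_ofPred_eq, not_and_or, not_le] at h
    rcases h with h | h
    · exact Or.inl ⟨h.le, trivial⟩
    · exact Or.inr ⟨trivial, h.le⟩
  refine (measure_mono hsub).trans ((measure_union_le _ _).trans ?_)
  rw [dataLaw, Measure.prod_prod, Measure.prod_prod]
  simp only [measure_univ, mul_one, one_mul]
  exact add_le_add h1 h2

/-! ### Bounds for the two planar densities -/

/-- The numerical circumstances under which the approximation is uniform: both sample sizes are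
comparable to `n`, the variances `s₀ ≤ w = s₀ + meanSq μ₀` stay in a fixed range, and the mean
squares `a = meanSq Y`, `b = meanSq Z` are within `M / √n` of their expectations. -/
structure TypicalData (β κ L M : ℝ) (n k l : ℕ) (s₀ w a b : ℝ) : Prop where
  le_k : β * n ≤ k
  k_le : k ≤ n
  le_l : β * n ≤ l
  l_le : l ≤ n
  le_s₀ : κ ≤ s₀
  s₀_le : s₀ ≤ w
  w_le : w ≤ L
  abs_a_le : |a - s₀| ≤ M / √n
  abs_b_le : |b - w| ≤ M / √n

section
variable {β κ L M : ℝ} {n k l : ℕ} {s₀ w a b : ℝ}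

/-- A density on `[0, ∞)` extended by zero to the negative half line. -/
noncomputable def zeroExtend (f : ℝ → ℝ) : ℝ → ℝ≥0∞ :=
  (Set.Ici 0).indicator fun x => ENNReal.ofReal (f x)

lemma measurable_zeroExtend {f : ℝ → ℝ} (hf : ContinuousOn f (Set.Ici 0)) :
    Measurable (zeroExtend f) := by
  have h : Measurable ((Set.Ici 0).indicator f) := by
    classical
    rw [← Set.piecewise_eq_indicator]
    exact hf.measurable_piecewise continuousOn_const measurableSet_Ici
  have e : zeroExtend f = fun x => ENNReal.ofReal ((Set.Ici 0).indicator f x) := by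
    ext x
    by_cases hx : x ∈ Set.Ici (0 : ℝ)
    · simp [zeroExtend, Set.indicator_of_mem hx]
    · simp [zeroExtend, Set.indicator_of_notMem hx]
  rw [e]
  exact h.ennreal_ofReal

lemma lintegral_zeroExtend (f : ℝ → ℝ) :
    ∫⁻ x, zeroExtend f x = ∫⁻ x in Set.Ici 0, ENNReal.ofReal (f x) :=
  lintegral_indicator measurableSet_Ici _

/-- On a bounded range the posterior density has Gaussian decay; elsewhere it is exponentially small
relative to the prior. -/
lemma jointDensity_le {γ π : ℝ → ℝ} {B : ℝ} (hγ_pos : ∀ x, 0 ≤ x → 0 < γ x)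
    (hπ_pos : ∀ x, 0 ≤ x → 0 < π x) (hγB : ∀ x ∈ Set.Icc 0 (2 * L), γ x ≤ B)
    (hπB : ∀ x ∈ Set.Icc 0 (2 * L), π x ≤ B) (hβ : 0 < β) (hL : 1 ≤ L)
    (hk : β * n ≤ k) (hl : β * n ≤ l) (ha : 0 < a) (haL : a ≤ L) (hb : 0 < b) (hbL : b ≤ L)
    (s v : ℝ) :
    jointDensity γ π k l a b s v ≤
      ENNReal.ofReal (B * B * Real.exp (-(β / (16 * L ^ 2) * n * ((s - a) ^ 2 + (v - b) ^ 2)))) +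
      ENNReal.ofReal (Real.exp (-(β / (16 * L ^ 2) * n))) *
        (zeroExtend π s * zeroExtend γ (v - s)) := by
  have hL0 : 0 < L := by linarith
  have hn : (0 : ℝ) ≤ n := n.cast_nonneg
  have hβn : 0 ≤ β * n := by positivity
  rw [jointDensity]
  by_cases h : (s, v) ∈ {p : ℝ × ℝ | 0 < p.1 ∧ p.1 < p.2}
  swap
  · rw [Set.indicator_of_notMem h]; exact zero_le
  rw [Set.indicator_of_mem h]
  obtain ⟨hs, hsv⟩ : 0 < s ∧ s < v := h
  have hv : 0 < v := hs.trans hsv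
  have hπs := hπ_pos s hs.le
  have hγs := hγ_pos (v - s) (by linarith)
  have ga := entropyGap_div_nonneg ha hs
  have gb := entropyGap_div_nonneg hb hv
  by_cases hLv : v ≤ 2 * L
  · have hLs : s ≤ 2 * L := hsv.le.trans hLv
    refine le_add_right (ENNReal.ofReal_le_ofReal ?_)
    have h1 : π s ≤ B := hπB s ⟨hs.le, hLs⟩
    have h2 : γ (v - s) ≤ B := hγB (v - s) ⟨by linarith, by linarith⟩
    have hB : 0 ≤ B := hπs.le.trans h1
    have q {x a y : ℝ} (ha : 0 < a) (haL : a ≤ L) (hx : 0 < x) (hxL : x ≤ 2 * L)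
        (hy : β * n ≤ y) : β / (16 * L ^ 2) * n * (x - a) ^ 2 ≤ y / 2 * entropyGap (a / x) := by
      calc β / (16 * L ^ 2) * n * (x - a) ^ 2
          = β * n / 2 * ((x - a) ^ 2 / (2 * (2 * L) ^ 2)) := by field_simp; ring
        _ ≤ y / 2 * entropyGap (a / x) := by
          have hy0 : 0 ≤ y / 2 := by linarith
          have := sq_le_entropyGap_div ha hx (L := 2 * L) (by linarith) hxL
          gcongr
    have qa := q ha haL hs hLs hk
    have qb := q hb hbL hv hLv hl
    gcongr
    linarith
  · refine le_add_left ?_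
    have hE : β / (16 * L ^ 2) * n ≤ k / 2 * entropyGap (a / s) + l / 2 * entropyGap (b / v) := by
      have : β / (16 * L ^ 2) * n ≤ l / 2 * entropyGap (b / v) :=
        calc β / (16 * L ^ 2) * n = β * n / 2 * (1 / 8) * (1 / L ^ 2) := by field_simp; ring
          _ ≤ β * n / 2 * (1 / 8) * 1 := by
            gcongr
            rw [div_le_one (by positivity)]; nlinarith
          _ ≤ l / 2 * entropyGap (b / v) := by
            rw [mul_one]
            have := entropyGap_div_ge_of_two_mul_le hb (show 2 * b ≤ v by linarith)
            gcongr
      have h2 : 0 ≤ k / 2 * entropyGap (a / s) := by positivity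
      linarith
    rw [zeroExtend, zeroExtend, Set.indicator_of_mem (by simpa using hs.le),
      Set.indicator_of_mem (by simpa using hsv.le), ← ENNReal.ofReal_mul hπs.le,
      ← ENNReal.ofReal_mul (Real.exp_pos _).le]
    apply ENNReal.ofReal_le_ofReal
    rw [mul_comm (Real.exp _)]
    gcongr

lemma gaussDensity_le (T : Set (ℝ × ℝ)) (hβ : 0 < β) (hk : β * n ≤ k)
    (hl : β * n ≤ l) (hs₀ : 0 < s₀) (hs₀L : s₀ ≤ L) (hw : 0 < w) (hwL : w ≤ L) (s v : ℝ) :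
    gaussDensity T k l s₀ w a b s v ≤
      ENNReal.ofReal (Real.exp (-(β / (16 * L ^ 2) * n * ((s - a) ^ 2 + (v - b) ^ 2)))) := by
  rw [gaussDensity]
  refine (Set.indicator_le_self _ _ _).trans (ENNReal.ofReal_le_ofReal (Real.exp_le_exp.2 ?_))
  have hn : (0 : ℝ) ≤ n := n.cast_nonneg
  have hL0 : 0 < L := hw.trans_le hwL
  have q {x y : ℝ} (hx : 0 < x) (hxL : x ≤ L) (hy : β * n ≤ y) :
      β / (16 * L ^ 2) * n ≤ y / (4 * x ^ 2) := by
    calc β / (16 * L ^ 2) * n = β * n / (16 * L ^ 2) := by ring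
      _ ≤ y / (4 * x ^ 2) := by
        have : 0 ≤ y := le_trans (by positivity) hy
        gcongr
        norm_num
  have h1 := mul_le_mul_of_nonneg_right (q hs₀ hs₀L hk) (sq_nonneg (s - a))
  have h2 := mul_le_mul_of_nonneg_right (q hw hwL hl) (sq_nonneg (v - b))
  linarith

/-- The limit density has mass of order at least `1 / n`: it is bounded below on a square of side
`1 / √n` inside the half plane `s < v`. -/
lemma ofReal_le_lintegral_gaussDensity (h : TypicalData β κ L M n k l s₀ w a b) (hn : 0 < n)
    (hκ : 0 < κ) (hsmall : (3 * M + 1) / √n < κ) {T : Set (ℝ × ℝ)}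
    (hT : {p : ℝ × ℝ | 0 < p.1 ∧ p.1 < p.2} ⊆ T) :
    ENNReal.ofReal (Real.exp (-(((2 * M + 1) ^ 2 + 1) / (4 * κ ^ 2))) / n) ≤
      ∫⁻ s, ∫⁻ v, gaussDensity T k l s₀ w a b s v := by
  have hn' : (0 : ℝ) < n := by exact_mod_cast hn
  set h' := 1 / √(n : ℝ) with hh'
  have hh0 : 0 < h' := by positivity
  have hh2 : n * h' ^ 2 = 1 := by
    rw [hh', div_pow, one_pow, Real.sq_sqrt hn'.le]; field_simp
  have hMh : M / √n = M * h' := by rw [hh']; ring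
  have ha := h.abs_a_le
  have hb := h.abs_b_le
  rw [hMh] at ha hb
  have hsm : (3 * M + 1) * h' < κ := by rw [hh', mul_one_div]; exact hsmall
  have hs₀κ := h.le_s₀
  have hs₀w := h.s₀_le
  rw [abs_le] at ha hb
  set I := Set.Icc (a - (2 * M + 1) * h') (a - 2 * M * h')
  set J := Set.Ioc b (b + h')
  set E := Real.exp (-(((2 * M + 1) ^ 2 + 1) / (4 * κ ^ 2))) with hE
  have key : ∀ s ∈ I, ∀ v ∈ J, ENNReal.ofReal E ≤ gaussDensity T k l s₀ w a b s v := by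
    rintro s ⟨hs1, hs2⟩ v ⟨hv1, hv2⟩
    have hs : 0 < s := by nlinarith
    have hsv : s < v := by nlinarith
    rw [gaussDensity, Set.indicator_of_mem (hT ⟨hs, hsv⟩)]
    refine ENNReal.ofReal_le_ofReal (Real.exp_le_exp.2 (neg_le_neg ?_))
    have q {x y d m : ℝ} (hx : κ ≤ x) (hy0 : 0 ≤ y) (hy : y ≤ n) (hd : |d| ≤ m * h') :
        y / (4 * x ^ 2) * d ^ 2 ≤ m ^ 2 / (4 * κ ^ 2) := by
      calc y / (4 * x ^ 2) * d ^ 2 ≤ n / (4 * κ ^ 2) * (m * h') ^ 2 := by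
            rw [← sq_abs d]; gcongr
        _ = m ^ 2 * (n * h' ^ 2) / (4 * κ ^ 2) := by ring
        _ = m ^ 2 / (4 * κ ^ 2) := by rw [hh2, mul_one]
    have q1 := q (x := s₀) (y := k) (d := s - a) (m := 2 * M + 1) hs₀κ k.cast_nonneg
      (by exact_mod_cast h.k_le) (by rw [abs_le]; constructor <;> nlinarith)
    have q2 := q (x := w) (y := l) (d := v - b) (m := 1) (hs₀κ.trans hs₀w) l.cast_nonneg
      (by exact_mod_cast h.l_le) (by rw [abs_le]; constructor <;> nlinarith)
    calc _ ≤ _ := add_le_add q1 q2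
      _ = _ := by ring
  calc ENNReal.ofReal (E / n) = ENNReal.ofReal E * volume J * volume I := by
        have hI : volume I = ENNReal.ofReal h' := by rw [Real.volume_Icc]; congr 1; ring
        have hJ : volume J = ENNReal.ofReal h' := by rw [Real.volume_Ioc]; congr 1; ring
        rw [hI, hJ, ← ENNReal.ofReal_mul (by positivity), ← ENNReal.ofReal_mul (by positivity)]
        congr 1
        have : (n : ℝ)⁻¹ = h' ^ 2 := by
          rw [eq_comm, ← mul_right_inj' hn'.ne', hh2, mul_inv_cancel₀ hn'.ne']
        rw [div_eq_mul_inv, this]; ring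
    _ = ∫⁻ s in I, ∫⁻ v in J, ENNReal.ofReal E := by simp
    _ ≤ ∫⁻ s in I, ∫⁻ v in J, gaussDensity T k l s₀ w a b s v := by
        refine setLIntegral_mono' measurableSet_Icc fun s hs => ?_
        exact setLIntegral_mono' measurableSet_Ioc fun v hv => key s hs v hv
    _ ≤ ∫⁻ s in I, ∫⁻ v, gaussDensity T k l s₀ w a b s v :=
        lintegral_mono fun s => setLIntegral_le_lintegral _ _
    _ ≤ _ := setLIntegral_le_lintegral _ _

/-- In a window of width `d`, of order `1 / √n`, around the peaks the posterior density agrees with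
the Gaussian density up to a factor close to `1`. -/
lemma abs_density_sub_le {γ π : ℝ → ℝ} (hγ_pos : ∀ x, 0 ≤ x → 0 < γ x)
    (hπ_pos : ∀ x, 0 ≤ x → 0 < π x) {δ η d s v : ℝ}
    (hγ : ∀ x ∈ Set.Icc 0 (2 * L), ∀ y ∈ Set.Icc 0 (2 * L), |x - y| ≤ δ →
      |Real.log (γ x) - Real.log (γ y)| ≤ η)
    (hπ : ∀ x ∈ Set.Icc 0 (2 * L), ∀ y ∈ Set.Icc 0 (2 * L), |x - y| ≤ δ →
      |Real.log (π x) - Real.log (π y)| ≤ η)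
    (hη : 4 * η ≤ 1) (hκ : 0 < κ) (h : TypicalData β κ L M n k l s₀ w a b)
    (hdδ : 2 * d ≤ δ) (hdκ : 4 * d ≤ κ) (hdn : 12 * n * d ^ 3 / κ ^ 3 ≤ η)
    (hs : 0 < s) (hsv : s < v) (h1 : |s - a| ≤ d) (h2 : |s - s₀| ≤ d) (h3 : |v - b| ≤ d)
    (h4 : |v - w| ≤ d) :
    |(π s₀ * γ (w - s₀))⁻¹ * (π s * γ (v - s) *
        Real.exp (-(k / 2 * entropyGap (a / s) + l / 2 * entropyGap (b / v)))) -
      Real.exp (-(k / (4 * s₀ ^ 2) * (s - a) ^ 2 + l / (4 * w ^ 2) * (v - b) ^ 2))| ≤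
      8 * η * Real.exp (-(k / (4 * s₀ ^ 2) * (s - a) ^ 2 + l / (4 * w ^ 2) * (v - b) ^ 2)) := by
  have hs₀κ := h.le_s₀
  have hs₀w := h.s₀_le
  have hwL := h.w_le
  have hd0 : 0 ≤ d := (abs_nonneg _).trans h1
  have h2' := abs_le.1 h2
  have h4' := abs_le.1 h4
  have hs₀ : 0 < s₀ := hκ.trans_le hs₀κ
  have hw : 0 < w := hs₀.trans_le hs₀w
  set x1 := Real.log (π s) - Real.log (π s₀)
  set x2 := Real.log (γ (v - s)) - Real.log (γ (w - s₀))
  set x3 := k / 2 * (entropyGap (a / s) - (s - a) ^ 2 / (2 * s₀ ^ 2))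
  set x4 := l / 2 * (entropyGap (b / v) - (v - b) ^ 2 / (2 * w ^ 2))
  have b1 : |x1| ≤ η := hπ s ⟨hs.le, by linarith⟩ s₀ ⟨hs₀.le, by linarith⟩ (by linarith)
  have b2 : |x2| ≤ η := by
    refine hγ _ ⟨by linarith, by linarith⟩ _ ⟨by linarith, by linarith⟩ ?_
    rw [abs_le]; constructor <;> linarith
  have hcub {y z : ℝ} (hy0 : 0 ≤ y) (hyn : y ≤ n) (hz : |z| ≤ 3 * d ^ 3 / (κ / 2) ^ 3) :
      |y / 2 * z| ≤ η := by
    rw [abs_mul, abs_of_nonneg (by positivity : 0 ≤ y / 2)]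
    calc y / 2 * |z| ≤ n / 2 * (3 * d ^ 3 / (κ / 2) ^ 3) := by gcongr
      _ = 12 * n * d ^ 3 / κ ^ 3 := by field_simp; ring
      _ ≤ η := hdn
  have b3 : |x3| ≤ η := hcub k.cast_nonneg (by exact_mod_cast h.k_le)
    (abs_entropyGap_div_sub_le (by positivity) (by linarith) (by linarith) h1 h2 (by linarith))
  have b4 : |x4| ≤ η := hcub l.cast_nonneg (by exact_mod_cast h.l_le)
    (abs_entropyGap_div_sub_le (by positivity) (by linarith) (by linarith) h3 h4 (by linarith))
  set G := Real.exp (-(k / (4 * s₀ ^ 2) * (s - a) ^ 2 + l / (4 * w ^ 2) * (v - b) ^ 2)) with hG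
  have hX : |x1 + x2 - x3 - x4| ≤ 4 * η := by
    rw [abs_le] at *; constructor <;> linarith
  have e : (π s₀ * γ (w - s₀))⁻¹ * (π s * γ (v - s) *
        Real.exp (-(k / 2 * entropyGap (a / s) + l / 2 * entropyGap (b / v)))) =
      Real.exp (x1 + x2 - x3 - x4) * G := by
    have p1 : Real.exp x1 = π s / π s₀ := by
      rw [Real.exp_sub, Real.exp_log (hπ_pos _ hs.le), Real.exp_log (hπ_pos _ hs₀.le)]
    have p2 : Real.exp x2 = γ (v - s) / γ (w - s₀) := by
      rw [Real.exp_sub, Real.exp_log (hγ_pos _ (by linarith)),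
        Real.exp_log (hγ_pos _ (by linarith))]
    have p3 : -(k / 2 * entropyGap (a / s) + l / 2 * entropyGap (b / v)) = -x3 + -x4 +
        -(k / (4 * s₀ ^ 2) * (s - a) ^ 2 + l / (4 * w ^ 2) * (v - b) ^ 2) := by
      simp only [x3, x4]; field_simp; ring
    have p4 : x1 + x2 - x3 - x4 = x1 + x2 + (-x3 + -x4) := by ring
    rw [p3, p4, Real.exp_add, ← hG, Real.exp_add (x1 + x2), Real.exp_add x1, p1, p2]
    field_simp
  have hG0 : 0 < G := Real.exp_pos _
  rw [e, show Real.exp (x1 + x2 - x3 - x4) * G - G = (Real.exp (x1 + x2 - x3 - x4) - 1) * G by ring,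
    abs_mul, abs_of_pos hG0]
  have := Real.abs_exp_sub_one_le (hX.trans hη)
  gcongr
  linarith

end

/-! ### Uniform approximation of the posterior on typical data -/

lemma exists_log_modulus {f : ℝ → ℝ} (hf : ContinuousOn f (Set.Ici 0))
    (hf_pos : ∀ x, 0 ≤ x → 0 < f x) (L : ℝ) {η : ℝ} (hη : 0 < η) :
    ∃ δ > 0, ∀ x ∈ Set.Icc 0 L, ∀ y ∈ Set.Icc 0 L, |x - y| ≤ δ →
      |Real.log (f x) - Real.log (f y)| ≤ η := by
  have hc : ContinuousOn (fun x => Real.log (f x)) (Set.Icc 0 L) :=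
    (hf.mono Set.Icc_subset_Ici_self).log fun x hx => (hf_pos x hx.1).ne'
  have hu := isCompact_Icc.uniformContinuousOn_of_continuous hc
  obtain ⟨δ, hδ, h⟩ := Metric.uniformContinuousOn_iff.1 hu η hη
  refine ⟨δ / 2, by positivity, fun x hx y hy hxy => ?_⟩
  exact (h x hx y hy (by rw [Real.dist_eq]; linarith)).le

lemma exists_pos_bounds {f : ℝ → ℝ} (hf : ContinuousOn f (Set.Ici 0))
    (hf_pos : ∀ x, 0 ≤ x → 0 < f x) {L : ℝ} (hL : 0 ≤ L) :
    ∃ c > 0, ∃ C, ∀ x ∈ Set.Icc 0 L, c ≤ f x ∧ f x ≤ C := by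
  have hc : ContinuousOn f (Set.Icc 0 L) := hf.mono Set.Icc_subset_Ici_self
  have hne : (Set.Icc 0 L).Nonempty := ⟨0, le_rfl, hL⟩
  obtain ⟨x, hx, hmin⟩ := isCompact_Icc.exists_isMinOn hne hc
  obtain ⟨y, hy, hmax⟩ := isCompact_Icc.exists_isMaxOn hne hc
  exact ⟨f x, hf_pos x hx.1, f y, fun z hz => ⟨hmin hz, hmax hz⟩⟩

/-- Measurability and total mass of the error density: a small multiple of the limit
density, a Gaussian tail, and an exponentially small multiple of the prior. -/
lemma lintegral_error_eq {γ π : ℝ → ℝ} (hγ : ContinuousOn γ (Set.Ici 0))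
    (hπ : ContinuousOn π (Set.Ici 0))
    (hγ_int : ∫⁻ x in Set.Ici (0 : ℝ), ENNReal.ofReal (γ x) = 1)
    (hπ_int : ∫⁻ x in Set.Ici (0 : ℝ), ENNReal.ofReal (π x) = 1)
    {H : ℝ → ℝ → ℝ≥0∞} (hH : Measurable (Function.uncurry H)) (η A B : ℝ) {τ : ℝ} (hτ : 0 < τ)
    (a b : ℝ) :
    Measurable (Function.uncurry fun s v => ENNReal.ofReal η * H s v +
      (ENNReal.ofReal A * (ENNReal.ofReal (Real.exp (-(τ * (s - a) ^ 2))) *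
          ENNReal.ofReal (Real.exp (-(τ * (v - b) ^ 2)))) +
        ENNReal.ofReal B * (zeroExtend π s * zeroExtend γ (v - s)))) ∧
    ∫⁻ s, ∫⁻ v, (ENNReal.ofReal η * H s v +
      (ENNReal.ofReal A * (ENNReal.ofReal (Real.exp (-(τ * (s - a) ^ 2))) *
          ENNReal.ofReal (Real.exp (-(τ * (v - b) ^ 2)))) +
        ENNReal.ofReal B * (zeroExtend π s * zeroExtend γ (v - s)))) =
      ENNReal.ofReal η * (∫⁻ s, ∫⁻ v, H s v) +
        (ENNReal.ofReal A * ENNReal.ofReal (Real.pi / τ) + ENNReal.ofReal B) := by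
  have mγ := measurable_zeroExtend hγ
  have mπ := measurable_zeroExtend hπ
  have m1 : Measurable fun p : ℝ × ℝ => ENNReal.ofReal η * H p.1 p.2 := hH.const_mul _
  have m2 : Measurable fun p : ℝ × ℝ =>
      ENNReal.ofReal A * (ENNReal.ofReal (Real.exp (-(τ * (p.1 - a) ^ 2))) *
        ENNReal.ofReal (Real.exp (-(τ * (p.2 - b) ^ 2)))) := by fun_prop
  have m3 : Measurable fun p : ℝ × ℝ =>
      ENNReal.ofReal B * (zeroExtend π p.1 * zeroExtend γ (p.2 - p.1)) := by fun_prop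
  refine ⟨m1.add (m2.add m3), ?_⟩
  have n1 (s : ℝ) := m1.comp (measurable_prodMk_left (x := s))
  have n2 (s : ℝ) := m2.comp (measurable_prodMk_left (x := s))
  have hsplit (s : ℝ) : ∫⁻ v, (ENNReal.ofReal η * H s v +
      (ENNReal.ofReal A * (ENNReal.ofReal (Real.exp (-(τ * (s - a) ^ 2))) *
          ENNReal.ofReal (Real.exp (-(τ * (v - b) ^ 2)))) +
        ENNReal.ofReal B * (zeroExtend π s * zeroExtend γ (v - s)))) =
      ENNReal.ofReal η * (∫⁻ v, H s v) +
      (ENNReal.ofReal A * (ENNReal.ofReal (Real.exp (-(τ * (s - a) ^ 2))) *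
          ENNReal.ofReal √(Real.pi / τ)) + ENNReal.ofReal B * zeroExtend π s) := by
    have hπs : zeroExtend π s ≠ ∞ := by
      rw [zeroExtend]
      exact ne_top_of_le_ne_top ENNReal.ofReal_ne_top (Set.indicator_le_self _ _ _)
    have e1 := lintegral_add_left (n1 s) (fun v =>
      (ENNReal.ofReal A * (ENNReal.ofReal (Real.exp (-(τ * (s - a) ^ 2))) *
          ENNReal.ofReal (Real.exp (-(τ * (v - b) ^ 2)))) +
        ENNReal.ofReal B * (zeroExtend π s * zeroExtend γ (v - s)))) (μ := volume)
    have e2 := lintegral_add_left (n2 s) (fun v =>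
        ENNReal.ofReal B * (zeroExtend π s * zeroExtend γ (v - s))) (μ := volume)
    simp only [Function.comp_apply] at e1 e2
    rw [e1, e2, lintegral_const_mul' _ _ ENNReal.ofReal_ne_top,
      lintegral_const_mul' _ _ ENNReal.ofReal_ne_top,
      lintegral_const_mul' _ _ ENNReal.ofReal_ne_top,
      lintegral_const_mul' _ _ ENNReal.ofReal_ne_top, lintegral_const_mul' _ _ hπs,
      lintegral_exp_neg_mul_sub_sq hτ, lintegral_sub_right_eq_self (zeroExtend γ) s,
      lintegral_zeroExtend, hγ_int, mul_one]
  simp_rw [hsplit]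
  have k1 : Measurable fun s => ENNReal.ofReal η * ∫⁻ v, H s v :=
    hH.lintegral_prod_right'.const_mul _
  rw [lintegral_add_left k1, lintegral_add_left (by fun_prop),
    lintegral_const_mul' _ _ ENNReal.ofReal_ne_top, lintegral_const_mul' _ _ ENNReal.ofReal_ne_top,
    lintegral_const_mul' _ _ ENNReal.ofReal_ne_top, lintegral_mul_const' _ _ ENNReal.ofReal_ne_top,
    lintegral_exp_neg_mul_sub_sq hτ, lintegral_zeroExtend, hπ_int, mul_one,
    ← ENNReal.ofReal_mul (Real.sqrt_nonneg _), Real.mul_self_sqrt (by positivity)]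

lemma lintegral_gaussDensity_ne_top (T : Set (ℝ × ℝ)) {k l : ℕ} (hk : 0 < k) (hl : 0 < l)
    {s₀ w : ℝ} (hs₀ : 0 < s₀) (hw : 0 < w) (a b : ℝ) :
    ∫⁻ s, ∫⁻ v, gaussDensity T k l s₀ w a b s v ≠ ∞ := by
  have hk' : (0 : ℝ) < k / (4 * s₀ ^ 2) := by positivity
  have hl' : (0 : ℝ) < l / (4 * w ^ 2) := by positivity
  have hle : ∀ s v, gaussDensity T k l s₀ w a b s v ≤
      ENNReal.ofReal (Real.exp (-(k / (4 * s₀ ^ 2) * (s - a) ^ 2))) *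
        ENNReal.ofReal (Real.exp (-(l / (4 * w ^ 2) * (v - b) ^ 2))) := by
    intro s v
    rw [← ENNReal.ofReal_mul (Real.exp_pos _).le, ← Real.exp_add, ← neg_add]
    exact Set.indicator_le_self _ _ _
  refine ne_top_of_le_ne_top ?_ (lintegral_mono fun s => lintegral_mono fun v => hle s v)
  simp_rw [lintegral_const_mul' _ _ ENNReal.ofReal_ne_top, lintegral_exp_neg_mul_sub_sq hl']
  rw [lintegral_mul_const' _ _ ENNReal.ofReal_ne_top, lintegral_exp_neg_mul_sub_sq hk']
  exact ENNReal.mul_ne_top ENNReal.ofReal_ne_top ENNReal.ofReal_ne_top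

/-- Outside a window of radius `R / √n` half of the Gaussian exponent is spent on a small factor. -/
lemma exp_neg_sq_add_sq_le {n c R x y : ℝ} (hn : 0 < n) (hc : 0 < c) (hR : 0 < R)
    (h : ¬(|x| ≤ R / √n ∧ |y| ≤ R / √n)) :
    Real.exp (-(c * n * (x ^ 2 + y ^ 2))) ≤ Real.exp (-(c / 2 * R ^ 2)) *
      (Real.exp (-(c * n / 2 * x ^ 2)) * Real.exp (-(c * n / 2 * y ^ 2))) := by
  rw [← Real.exp_add, ← Real.exp_add]
  refine Real.exp_le_exp.2 ?_
  have hsq {x : ℝ} (hx : R / √n < |x|) : R ^ 2 ≤ n * x ^ 2 := by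
    have : (R / √n) ^ 2 ≤ |x| ^ 2 := by gcongr
    rw [div_pow, Real.sq_sqrt hn.le, sq_abs, div_le_iff₀ hn] at this
    linarith
  have hq : R ^ 2 ≤ n * (x ^ 2 + y ^ 2) := by
    rw [mul_add]
    rcases not_and_or.1 h with h | h
    · linarith [hsq (not_le.1 h), show 0 ≤ n * y ^ 2 by positivity]
    · linarith [hsq (not_le.1 h), show 0 ≤ n * x ^ 2 by positivity]
  have := mul_le_mul_of_nonneg_left hq hc.le
  linarith

/-- Inside the window the normalised posterior density and the restricted Gaussian density differ by
at most a small fraction of the latter. -/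
lemma density_close_of_window {γ π : ℝ → ℝ} {β κ L M : ℝ} {n k l : ℕ} {s₀ w a b : ℝ}
    (hγ_pos : ∀ x, 0 ≤ x → 0 < γ x)
    (hπ_pos : ∀ x, 0 ≤ x → 0 < π x) {δ η R s v : ℝ}
    (hγ : ∀ x ∈ Set.Icc 0 (2 * L), ∀ y ∈ Set.Icc 0 (2 * L), |x - y| ≤ δ →
      |Real.log (γ x) - Real.log (γ y)| ≤ η)
    (hπ : ∀ x ∈ Set.Icc 0 (2 * L), ∀ y ∈ Set.Icc 0 (2 * L), |x - y| ≤ δ →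
      |Real.log (π x) - Real.log (π y)| ≤ η)
    (hη0 : 0 < η) (hη : 4 * η ≤ 1) (hκ : 0 < κ) (hd : TypicalData β κ L M n k l s₀ w a b)
    (hn : 0 < n) (hR : 0 ≤ R) (hM : 0 ≤ M)
    (hdδ : 2 * (R + M) / √n ≤ δ) (hdκ : 4 * (R + M) / √n ≤ κ)
    (hdn : 12 * (R + M) ^ 3 / κ ^ 3 / √n ≤ η) {T : Set (ℝ × ℝ)}
    (hT1 : {p : ℝ × ℝ | 0 < p.1 ∧ p.1 < p.2} ⊆ T)
    (hT2 : (s, v) ∈ T → s < v) (h1 : |s - a| ≤ R / √n) (h2 : |v - b| ≤ R / √n) :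
    ENNReal.ofReal (π s₀ * γ (w - s₀))⁻¹ * jointDensity γ π k l a b s v ≤
        gaussDensity T k l s₀ w a b s v +
          ENNReal.ofReal (8 * η) * gaussDensity T k l s₀ w a b s v ∧
      gaussDensity T k l s₀ w a b s v ≤
        ENNReal.ofReal (π s₀ * γ (w - s₀))⁻¹ * jointDensity γ π k l a b s v +
          ENNReal.ofReal (8 * η) * gaussDensity T k l s₀ w a b s v := by
  have hn' : (0 : ℝ) < n := by exact_mod_cast hn
  have hsn : 0 < √(n : ℝ) := Real.sqrt_pos.2 hn'
  have hs₀κ := hd.le_s₀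
  have hs₀w := hd.s₀_le
  set Q := R + M with hQ
  have hRQ : R / √n ≤ Q / √n := by gcongr; linarith
  have hMR : R / √n + M / √n = Q / √n := by rw [hQ, add_div]
  have hQ0 : 0 ≤ Q / √n := by positivity
  have ha := abs_le.1 hd.abs_a_le
  have hb := abs_le.1 hd.abs_b_le
  have h1' := abs_le.1 h1
  have h2' := abs_le.1 h2
  rw [mul_div_assoc] at hdδ hdκ
  have hs : 0 < s := by linarith
  by_cases hsv : s < v
  swap
  · have hH0 : gaussDensity T k l s₀ w a b s v = 0 := by
      rw [gaussDensity]; exact Set.indicator_of_notMem (fun hmem => hsv (hT2 hmem)) _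
    have hF0 : jointDensity γ π k l a b s v = 0 := by
      rw [jointDensity]; exact Set.indicator_of_notMem (fun hm => hsv hm.2) _
    rw [hH0, hF0]; simp
  have hmem : (s, v) ∈ {p : ℝ × ℝ | 0 < p.1 ∧ p.1 < p.2} := ⟨hs, hsv⟩
  have hcub : 12 * n * (Q / √n) ^ 3 / κ ^ 3 ≤ η := by
    refine le_trans (le_of_eq ?_) hdn
    calc 12 * n * (Q / √n) ^ 3 / κ ^ 3 = 12 * √n ^ 2 * (Q / √n) ^ 3 / κ ^ 3 := by
          rw [Real.sq_sqrt hn'.le]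
      _ = 12 * Q ^ 3 / κ ^ 3 / √n := by field_simp
  have key := abs_density_sub_le hγ_pos hπ_pos hγ hπ hη hκ hd
    hdδ hdκ hcub hs hsv (h1.trans hRQ) (by rw [abs_le]; constructor <;> linarith) (h2.trans hRQ)
    (by rw [abs_le]; constructor <;> linarith)
  have hc₀ : 0 ≤ (π s₀ * γ (w - s₀))⁻¹ :=
    inv_nonneg.2 (mul_pos (hπ_pos _ (by linarith)) (hγ_pos _ (by linarith))).le
  have hF0 : 0 ≤ (π s₀ * γ (w - s₀))⁻¹ * (π s * γ (v - s) *
      Real.exp (-(k / 2 * entropyGap (a / s) + l / 2 * entropyGap (b / v)))) :=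
    mul_nonneg hc₀ (mul_nonneg (mul_pos (hπ_pos s hs.le) (hγ_pos _ (by linarith))).le
      (Real.exp_pos _).le)
  rw [gaussDensity, Set.indicator_of_mem (hT1 hmem), jointDensity, Set.indicator_of_mem hmem,
    ← ENNReal.ofReal_mul hc₀]
  rw [abs_le] at key
  constructor <;>
    rw [← ENNReal.ofReal_mul (by positivity), ← ENNReal.ofReal_add (by positivity)
      (by positivity)] <;>
    exact ENNReal.ofReal_le_ofReal (by linarith)

/-- The comparison of the posterior with a Gaussian law restricted to a set `T` which contains the
half plane `0 < s < v` and coincides with it, as far as `s > 0`, in the window of radius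
`R / √n`. -/
theorem exists_radius_eventually_tvDist_le {γ π : ℝ → ℝ}
    (hγ_pos : ∀ x, 0 ≤ x → 0 < γ x) (hπ_pos : ∀ x, 0 ≤ x → 0 < π x)
    (hγ : ContinuousOn γ (Set.Ici 0)) (hπ : ContinuousOn π (Set.Ici 0))
    (hγ_int : ∫⁻ x in Set.Ici (0 : ℝ), ENNReal.ofReal (γ x) = 1)
    (hπ_int : ∫⁻ x in Set.Ici (0 : ℝ), ENNReal.ofReal (π x) = 1)
    {β κ L M : ℝ} (hβ : 0 < β) (hκ : 0 < κ) (hL : 1 ≤ L) (hM : 0 ≤ M) {ε : ℝ} (hε : 0 < ε) :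
    ∃ R > 0, ∀ᶠ n : ℕ in atTop, ∀ (k l : ℕ) (s₀ w a b : ℝ),
      TypicalData β κ L M n k l s₀ w a b → ∀ T : Set (ℝ × ℝ), MeasurableSet T →
      {p : ℝ × ℝ | 0 < p.1 ∧ p.1 < p.2} ⊆ T →
      (∀ s v, |s - a| ≤ R / √n → |v - b| ≤ R / √n → (s, v) ∈ T → s < v) →
      tvDist (lawOfDensity fun s => ∫⁻ v, jointDensity γ π k l a b s v)
        (lawOfDensity fun s => ∫⁻ v, gaussDensity T k l s₀ w a b s v) ≤ ENNReal.ofReal ε := by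
  -- `b` may exceed `L` by `M / √n ≤ 1`.
  set L' := L + 1 with hL'
  have hL'1 : 1 ≤ L' := by linarith
  obtain ⟨cγ, hcγ, Bγ, hBγ⟩ := exists_pos_bounds hγ hγ_pos (L := 2 * L') (by linarith)
  obtain ⟨cπ, hcπ, Bπ, hBπ⟩ := exists_pos_bounds hπ hπ_pos (L := 2 * L') (by linarith)
  set B := max Bγ Bπ with hB
  have hBγ' : ∀ x ∈ Set.Icc 0 (2 * L'), γ x ≤ B := fun x hx => (hBγ x hx).2.trans (le_max_left _ _)
  have hBπ' : ∀ x ∈ Set.Icc 0 (2 * L'), π x ≤ B := fun x hx => (hBπ x hx).2.trans (le_max_right _ _)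
  have hB0 : 0 < B := (hγ_pos 0 le_rfl).trans_le (hBγ' 0 ⟨le_rfl, by linarith⟩)
  set C := (B * B + 1) / (cπ * cγ) + 1 with hC
  have hC1 : 1 ≤ C := by rw [hC]; linarith [show 0 ≤ (B * B + 1) / (cπ * cγ) by positivity]
  -- The three error terms amount to `8 η + η + η` times the mass of the limit density, which
  -- normalisation doubles.
  set η := min (ε / 20) (1 / 4) with hη
  have hη0 : 0 < η := by positivity
  have hη4 : 4 * η ≤ 1 := by linarith [min_le_right (ε / 20) (1 / 4)]
  have hηε : 20 * η ≤ ε := by linarith [min_le_left (ε / 20) (1 / 4)]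
  obtain ⟨δγ, hδγ, hδγ'⟩ := exists_log_modulus hγ hγ_pos (2 * L') hη0
  obtain ⟨δπ, hδπ, hδπ'⟩ := exists_log_modulus hπ hπ_pos (2 * L') hη0
  set c := β / (16 * L' ^ 2) with hc
  have hc0 : 0 < c := by positivity
  set g := Real.exp (-(((2 * M + 1) ^ 2 + 1) / (4 * κ ^ 2))) with hg
  have hg0 : 0 < g := Real.exp_pos _
  -- The radius makes the Gaussian tail outside the window negligible against the mass `g / n`.
  have hR : ∃ R > 0, C * Real.exp (-(c / 2 * R ^ 2)) * (Real.pi / (c / 2)) ≤ η * g := by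
    have hlim : Tendsto (fun R : ℝ => C * Real.exp (-(c / 2 * R ^ 2)) * (Real.pi / (c / 2))) atTop
        (𝓝 (C * 0 * (Real.pi / (c / 2)))) := by
      refine (Tendsto.const_mul _ (Real.tendsto_exp_neg_atTop_nhds_zero.comp ?_)).mul_const _
      exact (tendsto_pow_atTop (by norm_num)).const_mul_atTop (by positivity)
    have hpos : C * 0 * (Real.pi / (c / 2)) < η * g := by simp; positivity
    obtain ⟨R, h1, h2⟩ := ((hlim.eventually_le_const hpos).and (eventually_gt_atTop 0)).exists
    exact ⟨R, h2, h1⟩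
  obtain ⟨R, hR0, hR⟩ := hR
  refine ⟨R, hR0, ?_⟩
  set Q := R + M with hQ
  have hQ0 : 0 < Q := by positivity
  have hsqrt : Tendsto (fun n : ℕ => √(n : ℝ)) atTop atTop :=
    Real.tendsto_sqrt_atTop.comp tendsto_natCast_atTop_atTop
  have hdiv (x : ℝ) : Tendsto (fun n : ℕ => x / √(n : ℝ)) atTop (𝓝 0) :=
    tendsto_const_nhds.div_atTop hsqrt
  have hexp : Tendsto (fun n : ℕ => n * (C * Real.exp (-(c * n)))) atTop (𝓝 0) := by
    have h1 := Real.tendsto_pow_mul_exp_neg_atTop_nhds_zero 1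
    have h2 : Tendsto (fun n : ℕ => c * (n : ℝ)) atTop atTop :=
      tendsto_natCast_atTop_atTop.const_mul_atTop hc0
    have h3 := (h1.comp h2).const_mul (C / c)
    rw [mul_zero] at h3
    refine h3.congr fun n => ?_
    simp only [Function.comp_apply]
    field_simp
  filter_upwards [eventually_gt_atTop 0, (hdiv (3 * M + 1)).eventually_lt_const hκ,
    (hdiv (2 * Q)).eventually_le_const hδγ, (hdiv (2 * Q)).eventually_le_const hδπ,
    (hdiv (4 * Q)).eventually_le_const hκ, (hdiv M).eventually_le_const one_pos,
    (hdiv (2 * M)).eventually_le_const hκ,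
    (hdiv (12 * Q ^ 3 / κ ^ 3)).eventually_le_const hη0,
    hexp.eventually_le_const (show 0 < η * g by positivity)]
    with n hn hn1 hn2 hn3 hn4 hn5 hn6 hn7 hn8 k l s₀ w a b hd T hT hT1 hT2
  have hn' : (0 : ℝ) < n := by exact_mod_cast hn
  have hsn : 0 < √(n : ℝ) := Real.sqrt_pos.2 hn'
  have hk : 0 < k := by
    have : (0 : ℝ) < k := lt_of_lt_of_le (by positivity) hd.le_k
    exact_mod_cast this
  have hl : 0 < l := by
    have : (0 : ℝ) < l := lt_of_lt_of_le (by positivity) hd.le_l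
    exact_mod_cast this
  have hs₀κ := hd.le_s₀
  have hs₀w := hd.s₀_le
  have hwL := hd.w_le
  have hs₀ : 0 < s₀ := hκ.trans_le hs₀κ
  have hw : 0 < w := hs₀.trans_le hs₀w
  have ha := abs_le.1 hd.abs_a_le
  have hb := abs_le.1 hd.abs_b_le
  have h2M : 2 * (M / √n) ≤ κ := by rw [← mul_div_assoc]; exact hn6
  have ha0 : 0 < a := by linarith
  have hb0 : 0 < b := by linarith
  have hd' : TypicalData β κ L' M n k l s₀ w a b := { hd with w_le := by linarith }
  -- The prior density at the true parameter, by which the posterior density is normalised.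
  set c₀ := π s₀ * γ (w - s₀) with hc₀
  have hs₀mem : s₀ ∈ Set.Icc 0 (2 * L') := ⟨hs₀.le, by linarith⟩
  have hwmem : w - s₀ ∈ Set.Icc 0 (2 * L') := ⟨by linarith, by linarith⟩
  have hc₀le : cπ * cγ ≤ c₀ :=
    mul_le_mul (hBπ _ hs₀mem).1 (hBγ _ hwmem).1 hcγ.le (hπ_pos _ hs₀.le).le
  have hc₀0 : 0 < c₀ := lt_of_lt_of_le (by positivity) hc₀le
  have hinv : c₀⁻¹ ≤ (cπ * cγ)⁻¹ := by gcongr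
  have hC2 : c₀⁻¹ * (B * B) ≤ C := by
    calc c₀⁻¹ * (B * B) ≤ (cπ * cγ)⁻¹ * (B * B + 1) := by gcongr; linarith
      _ ≤ C := by rw [hC, div_eq_inv_mul]; linarith
  have hC3 : c₀⁻¹ ≤ C := by
    calc c₀⁻¹ ≤ (cπ * cγ)⁻¹ * (B * B + 1) := by
          refine hinv.trans (le_mul_of_one_le_right (by positivity) ?_); nlinarith
      _ ≤ C := by rw [hC, div_eq_inv_mul]; linarith
  set F : ℝ → ℝ → ℝ≥0∞ := fun s v => ENNReal.ofReal c₀⁻¹ * jointDensity γ π k l a b s v with hF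
  set H := gaussDensity T k l s₀ w a b with hH
  have hFlaw : (lawOfDensity fun s => ∫⁻ v, jointDensity γ π k l a b s v) =
      lawOfDensity fun s => ∫⁻ v, F s v := by
    simp only [hF]
    simp_rw [lintegral_const_mul' _ _ (ENNReal.ofReal_ne_top (r := c₀⁻¹))]
    rw [lawOfDensity_const_mul (by simpa using hc₀0) ENNReal.ofReal_ne_top]
  set τ := c * n / 2 with hτ
  have hτ0 : 0 < τ := by positivity
  set A := C * Real.exp (-(c / 2 * R ^ 2)) with hA
  set E := C * Real.exp (-(c * n)) with hE
  obtain ⟨hDmeas, hDint⟩ := lintegral_error_eq hγ hπ hγ_int hπ_int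
    (measurable_gaussDensity hT k l s₀ w a b) (8 * η) A E hτ0 a b
  have hmass := ofReal_le_lintegral_gaussDensity hd hn hκ hn1 hT1
  -- The two densities outside the window, then inside it.
  have htail {s v : ℝ} (h : ¬(|s - a| ≤ R / √n ∧ |v - b| ≤ R / √n)) :
      ENNReal.ofReal (C * Real.exp (-(c * n * ((s - a) ^ 2 + (v - b) ^ 2)))) ≤
        ENNReal.ofReal A * (ENNReal.ofReal (Real.exp (-(τ * (s - a) ^ 2))) *
          ENNReal.ofReal (Real.exp (-(τ * (v - b) ^ 2)))) := by
    rw [← ENNReal.ofReal_mul (Real.exp_pos _).le, ← ENNReal.ofReal_mul (by positivity)]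
    refine ENNReal.ofReal_le_ofReal ?_
    exact (mul_le_mul_of_nonneg_left (exp_neg_sq_add_sq_le hn' hc0 hR0 h)
      (zero_le_one.trans hC1)).trans_eq (by rw [hA, mul_assoc C])
  have hFH {s v : ℝ} (h : |s - a| ≤ R / √n ∧ |v - b| ≤ R / √n) :
      F s v ≤ H s v + ENNReal.ofReal (8 * η) * H s v ∧
      H s v ≤ F s v + ENNReal.ofReal (8 * η) * H s v :=
    density_close_of_window (δ := min δγ δπ) hγ_pos hπ_pos
      (fun x hx y hy hxy => hδγ' x hx y hy (hxy.trans (min_le_left _ _)))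
      (fun x hx y hy hxy => hδπ' x hx y hy (hxy.trans (min_le_right _ _))) hη0 hη4 hκ hd' hn
      hR0.le hM (le_min hn2 hn3) hn4 hn7 hT1 (hT2 s v h.1 h.2) h.1 h.2
  have hHtail (s v : ℝ) :
      H s v ≤ ENNReal.ofReal (C * Real.exp (-(c * n * ((s - a) ^ 2 + (v - b) ^ 2)))) := by
    refine (gaussDensity_le (L := L') T hβ hd.le_k hd.le_l hs₀ (by linarith) hw (by linarith)
      s v).trans
      (ENNReal.ofReal_le_ofReal ?_)
    exact le_mul_of_one_le_left (Real.exp_pos _).le hC1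
  have hFtail (s v : ℝ) :
      F s v ≤ ENNReal.ofReal (C * Real.exp (-(c * n * ((s - a) ^ 2 + (v - b) ^ 2)))) +
        ENNReal.ofReal E * (zeroExtend π s * zeroExtend γ (v - s)) := by
    have := jointDensity_le hγ_pos hπ_pos hBγ' hBπ' hβ hL'1 hd.le_k hd.le_l ha0
      (by linarith) hb0 (by linarith) s v
    refine (mul_le_mul_right this _).trans ?_
    rw [mul_add, ← mul_assoc (ENNReal.ofReal c₀⁻¹), ← ENNReal.ofReal_mul (by positivity),
      ← ENNReal.ofReal_mul (by positivity), ← mul_assoc c₀⁻¹]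
    have h2 : c₀⁻¹ * Real.exp (-(c * n)) ≤ E :=
      mul_le_mul_of_nonneg_right hC3 (Real.exp_pos _).le
    gcongr
  rw [hFlaw]
  refine (tvDist_marginal_le hDmeas (η := 10 * η)
    (by positivity) ?_ (lintegral_gaussDensity_ne_top T hk hl hs₀ hw a b) (fun s v => ?_)
    (fun s v => ?_) ?_).trans (ENNReal.ofReal_le_ofReal (by linarith))
  · refine (lt_of_lt_of_le ?_ hmass).ne'
    rw [ENNReal.ofReal_pos]; positivity
  · by_cases h : |s - a| ≤ R / √n ∧ |v - b| ≤ R / √n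
    · refine (hFH h).1.trans ?_
      gcongr
      exact le_self_add
    · refine (hFtail s v).trans (le_add_left (le_add_left ?_))
      gcongr
      exact htail h
  · by_cases h : |s - a| ≤ R / √n ∧ |v - b| ≤ R / √n
    · refine (hFH h).2.trans ?_
      gcongr
      exact le_self_add
    · exact (hHtail s v).trans
        (le_add_left (le_add_left (le_add_right (htail h))))
  · rw [hDint]
    have e1 : ENNReal.ofReal A * ENNReal.ofReal (Real.pi / τ) ≤ ENNReal.ofReal η *
        ∫⁻ s, ∫⁻ v, H s v := by
      refine le_trans ?_ (mul_le_mul_right hmass _)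
      rw [← ENNReal.ofReal_mul (by positivity), ← ENNReal.ofReal_mul hη0.le]
      refine ENNReal.ofReal_le_ofReal ?_
      calc A * (Real.pi / τ) = A * (Real.pi / (c / 2)) / n := by rw [hτ]; field_simp
        _ ≤ η * g / n := by gcongr
        _ = η * (g / n) := by ring
    have e2 : ENNReal.ofReal E ≤ ENNReal.ofReal η * ∫⁻ s, ∫⁻ v, H s v := by
      refine le_trans ?_ (mul_le_mul_right hmass _)
      rw [← ENNReal.ofReal_mul hη0.le]
      refine ENNReal.ofReal_le_ofReal ?_
      rw [← mul_div_assoc, le_div_iff₀ hn', mul_comm]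
      exact hn8
    refine (add_le_add_right (add_le_add e1 e2) _).trans (le_of_eq ?_)
    rw [← add_mul, ← add_mul, ← ENNReal.ofReal_add hη0.le hη0.le,
      ← ENNReal.ofReal_add (by positivity) (by positivity)]
    congr 2
    ring

/-! ### From typical data to expectations -/

lemma lintegral_le_add_measure_compl {Ω : Type*} [MeasurableSpace Ω] (P : Measure Ω)
    [IsProbabilityMeasure P] {f : Ω → ℝ≥0∞} {A : Set Ω} (hA : MeasurableSet A) {e : ℝ≥0∞}
    (h1 : ∀ x, f x ≤ 1) (he : ∀ x ∈ A, f x ≤ e) : ∫⁻ x, f x ∂P ≤ e + P Aᶜ := by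
  calc ∫⁻ x, f x ∂P ≤ ∫⁻ x, (e + Aᶜ.indicator 1 x) ∂P := by
        refine lintegral_mono fun x => ?_
        by_cases hx : x ∈ A
        · exact (he x hx).trans le_self_add
        · rw [Set.indicator_of_mem (by simpa using hx)]
          exact (h1 x).trans le_add_self
    _ = e + P Aᶜ := by
        rw [lintegral_add_left measurable_const, lintegral_indicator_one hA.compl]
        simp

instance isProbabilityMeasure_dataLaw (k l : ℕ) (s₀ : ℝ) (μ₀ : Fin l → ℝ) :
    IsProbabilityMeasure (dataLaw k l s₀ μ₀) := by
  unfold dataLaw; infer_instance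

lemma meanSq_le {l : ℕ} {μ : Fin l → ℝ} {B : ℝ} (h : ∀ i, |μ i| ≤ B) : meanSq μ ≤ B ^ 2 := by
  rcases Nat.eq_zero_or_pos l with rfl | hl
  · simp [meanSq]; positivity
  have hl' : (0 : ℝ) < l := by exact_mod_cast hl
  rw [meanSq, div_le_iff₀ hl']
  calc ∑ i, μ i ^ 2 ≤ ∑ _i : Fin l, B ^ 2 :=
        Finset.sum_le_sum fun i _ => by rw [← sq_abs]; gcongr; exact h i
    _ = B ^ 2 * l := by simp [mul_comm]

lemma le_meanSq {l : ℕ} (hl : 0 < l) {μ : Fin l → ℝ} {r : ℝ} (hr : 0 ≤ r) (h : ∀ i, r ≤ |μ i|) :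
    r ^ 2 ≤ meanSq μ := by
  have hl' : (0 : ℝ) < l := by exact_mod_cast hl
  rw [meanSq, le_div_iff₀ hl']
  calc r ^ 2 * l = ∑ _i : Fin l, r ^ 2 := by simp [mul_comm]
    _ ≤ ∑ i, μ i ^ 2 :=
        Finset.sum_le_sum fun i _ => by rw [← sq_abs (μ i)]; gcongr; exact h i

lemma meanSq_nonneg {l : ℕ} (μ : Fin l → ℝ) : 0 ≤ meanSq μ := by
  unfold meanSq; positivity

/-- The expected total variation distance between the posterior and a restricted Gaussian law is
small, uniformly over the parameters. The constants `M` and `R` govern the typical data and the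
window on which the restriction has to be the one to `s < v`. -/
theorem exists_eventually_lintegral_tvDist_le {γ π : ℝ → ℝ}
    (hγ_pos : ∀ x, 0 ≤ x → 0 < γ x) (hπ_pos : ∀ x, 0 ≤ x → 0 < π x)
    (hγ : ContinuousOn γ (Set.Ici 0)) (hπ : ContinuousOn π (Set.Ici 0))
    (hγ_int : ∫⁻ x in Set.Ici (0 : ℝ), ENNReal.ofReal (γ x) = 1)
    (hπ_int : ∫⁻ x in Set.Ici (0 : ℝ), ENNReal.ofReal (π x) = 1)
    {β κ L B : ℝ} (hβ : 0 < β) (hκ : 0 < κ) {ε : ℝ} (hε : 0 < ε) :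
    ∃ R > 0, ∃ M > 0, ∀ᶠ n : ℕ in atTop, ∀ k l : ℕ, β * n ≤ k → k ≤ n → β * n ≤ l → l ≤ n →
      ∀ s₀, κ ≤ s₀ → s₀ ≤ L → ∀ μ₀ : Fin l → ℝ, (∀ i, |μ₀ i| ≤ B) →
      ∀ T : Set (ℝ × ℝ), MeasurableSet T → {p : ℝ × ℝ | 0 < p.1 ∧ p.1 < p.2} ⊆ T →
      (∀ a b s v, |a - s₀| ≤ M / √n → |b - (s₀ + meanSq μ₀)| ≤ M / √n →
        |s - a| ≤ R / √n → |v - b| ≤ R / √n → (s, v) ∈ T → s < v) →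
      ∫⁻ x, tvDist (posterior γ π x.1 x.2) (lawOfDensity fun s => ∫⁻ v,
        gaussDensity T k l s₀ (s₀ + meanSq μ₀) (meanSq x.1) (meanSq x.2) s v)
          ∂(dataLaw k l s₀ μ₀) ≤ ENNReal.ofReal ε := by
  obtain ⟨C, hC0, hC⟩ := exists_variance_sq_gaussianReal_le (max L |B|)
  obtain ⟨M, hM0, hM⟩ : ∃ M > 0, 2 * (C / (β * M ^ 2)) ≤ ε / 2 := by
    have hlim : Tendsto (fun M : ℝ => 2 * (C / (β * M ^ 2))) atTop (𝓝 (2 * 0)) :=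
      (tendsto_const_nhds.div_atTop
        ((tendsto_pow_atTop (by norm_num)).const_mul_atTop hβ)).const_mul 2
    obtain ⟨M, h1, h2⟩ := ((hlim.eventually_le_const (show (2 : ℝ) * 0 < ε / 2 by
      simpa using hε)).and (eventually_gt_atTop 0)).exists
    exact ⟨M, h2, h1⟩
  obtain ⟨R, hR0, hR⟩ := exists_radius_eventually_tvDist_le hγ_pos hπ_pos hγ hπ hγ_int hπ_int
    (L := |L| + B ^ 2 + 1) hβ hκ (by linarith [abs_nonneg L, sq_nonneg B]) hM0.le (half_pos hε)
  refine ⟨R, hR0, M, hM0, ?_⟩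
  have hdiv : Tendsto (fun n : ℕ => M / √(n : ℝ)) atTop (𝓝 0) :=
    tendsto_const_nhds.div_atTop (Real.tendsto_sqrt_atTop.comp tendsto_natCast_atTop_atTop)
  filter_upwards [hR, eventually_gt_atTop 0, hdiv.eventually_lt_const hκ]
    with n hn hn0 hnκ k l hk hkn hl hln s₀ hs₀κ hs₀L μ₀ hμ₀ T hT hT1 hT2
  have hn' : (0 : ℝ) < n := by exact_mod_cast hn0
  have hs₀ : 0 < s₀ := hκ.trans_le hs₀κ
  have hkr : (0 : ℝ) < k := lt_of_lt_of_le (by positivity) hk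
  have hlr : (0 : ℝ) < l := lt_of_lt_of_le (by positivity) hl
  have hk0 : 0 < k := by exact_mod_cast hkr
  have hl0 : 0 < l := by exact_mod_cast hlr
  have hδ : 0 < M / √(n : ℝ) := by positivity
  set A := {x : (Fin k → ℝ) × (Fin l → ℝ) |
    |meanSq x.1 - s₀| ≤ M / √n ∧ |meanSq x.2 - (s₀ + meanSq μ₀)| ≤ M / √n} with hA
  have hAmeas : MeasurableSet A := by
    have h1 := measurable_meanSq k
    have h2 := measurable_meanSq l
    have h3 : Measurable fun x : (Fin k → ℝ) × (Fin l → ℝ) => |meanSq x.1 - s₀| := by fun_prop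
    have h4 : Measurable fun x : (Fin k → ℝ) × (Fin l → ℝ) =>
      |meanSq x.2 - (s₀ + meanSq μ₀)| := by fun_prop
    exact (measurableSet_le h3 measurable_const).inter (measurableSet_le h4 measurable_const)
  have hbad : dataLaw k l s₀ μ₀ Aᶜ ≤ ENNReal.ofReal (ε / 2) := by
    have hs₀' : ((s₀.toNNReal : NNReal) : ℝ) ≤ max L |B| := by
      rw [Real.coe_toNNReal _ hs₀.le]; exact hs₀L.trans (le_max_left _ _)
    refine (dataLaw_compl_le hk0 hl0 hs₀.le μ₀
      (hC 0 _ (by rw [abs_zero]; exact (abs_nonneg B).trans (le_max_right _ _)) hs₀')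
      (fun i => hC _ _ ((hμ₀ i).trans ((le_abs_self B).trans (le_max_right _ _))) hs₀') hδ).trans ?_
    have q {y : ℝ} (hy : β * n ≤ y) : C / (y * (M / √n) ^ 2) ≤ C / (β * M ^ 2) := by
      have : β * M ^ 2 ≤ y * (M / √n) ^ 2 := by
        rw [div_pow, Real.sq_sqrt hn'.le]
        calc β * M ^ 2 = β * n * (M ^ 2 / n) := by field_simp
          _ ≤ y * (M ^ 2 / n) := by gcongr
      gcongr
    rw [← ENNReal.ofReal_add (by positivity) (by positivity)]
    exact ENNReal.ofReal_le_ofReal (by linarith [q hk, q hl])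
  refine (lintegral_le_add_measure_compl _ hAmeas (e := ENNReal.ofReal (ε / 2))
    (f := fun x => tvDist (posterior γ π x.1 x.2) _)
    (fun x => tvDist_lawOfDensity_le_one _ _) ?_).trans ?_
  · rintro x ⟨h1, h2⟩
    have hm0 := meanSq_nonneg μ₀
    have ha : 0 < meanSq x.1 := by linarith [(abs_le.1 h1).1]
    have hb : 0 < meanSq x.2 := by linarith [(abs_le.1 h2).1]
    rw [posterior_eq_lawOfDensity hγ hγ_pos x.1 x.2 ha hb]
    refine hn k l s₀ (s₀ + meanSq μ₀) (meanSq x.1) (meanSq x.2)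
      ⟨hk, hkn, hl, hln, hs₀κ, by linarith, ?_, h1, h2⟩ T hT hT1
      (fun s v => hT2 _ _ s v h1 h2)
    linarith [meanSq_le hμ₀, le_abs_self L]
  · calc ENNReal.ofReal (ε / 2) + dataLaw k l s₀ μ₀ Aᶜ
        ≤ ENNReal.ofReal (ε / 2) + ENNReal.ofReal (ε / 2) := by gcongr
      _ = ENNReal.ofReal ε := by
        rw [← ENNReal.ofReal_add (by positivity) (by positivity), add_halves]

lemma eventually_le_floor_mul {α β : ℝ} (hβ : β < α) :
    ∀ᶠ n : ℕ in atTop, β * n ≤ ⌊(n : ℝ) * α⌋₊ := by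
  have h : Tendsto (fun n : ℕ => (α - β) * (n : ℝ)) atTop atTop :=
    tendsto_natCast_atTop_atTop.const_mul_atTop (by linarith)
  filter_upwards [h.eventually_ge_atTop 1] with n hn
  linarith [Nat.lt_floor_add_one ((n : ℝ) * α)]

/-- The lower bound on the means makes the gap `r² ≤ w - s₀` between the two peaks large compared
with `1 / √n`; the logarithm in the assumption is only used through `log n ≥ 1`. -/
lemma eventually_div_sqrt_lt_sq {r : ℕ → ℝ}
    (hr : Tendsto (fun n : ℕ => r n / (Real.log n / n) ^ (1 / 4 : ℝ)) atTop atTop) (D : ℝ) :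
    ∀ᶠ n : ℕ in atTop, 0 < r n ∧ D / √n < r n ^ 2 := by
  filter_upwards [hr.eventually_gt_atTop (max D 1), eventually_ge_atTop 3] with n hn hn3
  have hn' : (3 : ℝ) ≤ n := by exact_mod_cast hn3
  have hn0 : (0 : ℝ) < n := by linarith
  have hlog : 1 ≤ Real.log n := by
    rw [Real.le_log_iff_exp_le hn0]
    linarith [Real.exp_one_lt_d9]
  set x := (Real.log n / n) ^ (1 / 4 : ℝ) with hx
  have hx0 : 0 < x := by positivity
  have hx2 : 1 / √n ≤ x ^ 2 := by
    have e : x ^ 2 = √(Real.log n / n) := by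
      rw [hx, ← Real.rpow_natCast, ← Real.rpow_mul (by positivity), Real.sqrt_eq_rpow]
      norm_num
    rw [e, one_div, ← Real.sqrt_inv]
    apply Real.sqrt_le_sqrt
    rw [inv_eq_one_div]
    gcongr
  rw [lt_div_iff₀ hx0] at hn
  have hm1 : 1 ≤ max D 1 := le_max_right _ _
  have hr0 : 0 < r n := lt_of_le_of_lt (by positivity) hn
  refine ⟨hr0, ?_⟩
  calc D / √n = D * (1 / √n) := by ring
    _ ≤ max D 1 * (1 / √n) := by gcongr; exact le_max_left _ _
    _ ≤ max D 1 ^ 2 * x ^ 2 := by gcongr; nlinarith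
    _ = (max D 1 * x) ^ 2 := by ring
    _ < r n ^ 2 := by gcongr

lemma exists_bounds_of_isCompact {K : Set ℝ} (hK : IsCompact K) (hK_pos : K ⊆ Set.Ioi 0) :
    ∃ κ > 0, ∃ L, ∀ s ∈ K, κ ≤ s ∧ s ≤ L := by
  rcases K.eq_empty_or_nonempty with rfl | hne
  · exact ⟨1, one_pos, 0, by simp⟩
  · obtain ⟨x, hx, hmin⟩ := hK.exists_isMinOn hne continuousOn_id
    obtain ⟨y, hy, hmax⟩ := hK.exists_isMaxOn hne continuousOn_id
    exact ⟨x, hK_pos hx, y, fun z hz => ⟨hmin hz, hmax hz⟩⟩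

lemma tendsto_nhds_zero_of_forall_ofReal {f : ℕ → ℝ≥0∞}
    (h : ∀ ε : ℝ, 0 < ε → ∀ᶠ n in atTop, f n ≤ ENNReal.ofReal ε) : Tendsto f atTop (𝓝 0) := by
  rw [ENNReal.tendsto_nhds_zero]
  intro ε hε
  obtain ⟨δ, hδ0, hδ⟩ := ENNReal.lt_iff_exists_nnreal_btwn.1 hε
  filter_upwards [h δ (by exact_mod_cast hδ0)] with n hn
  exact hn.trans (by rw [ENNReal.ofReal_coe_nnreal]; exact hδ.le)

end PartialMeans

theorem mainTheorem3 (α : ℝ) (hα0 : 0 < α) (hα1 : α < 1)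
    (γ π : ℝ → ℝ)
    (hγ_pos : ∀ x, 0 ≤ x → 0 < γ x) (hπ_pos : ∀ x, 0 ≤ x → 0 < π x)
    (hγ_cont : UniformContinuousOn γ (Set.Ici 0)) (hπ_cont : UniformContinuousOn π (Set.Ici 0))
    (hγ_int : ∫⁻ x in Set.Ici (0 : ℝ), ENNReal.ofReal (γ x) = 1)
    (hπ_int : ∫⁻ x in Set.Ici (0 : ℝ), ENNReal.ofReal (π x) = 1)
    (K K' : Set ℝ) (hK : IsCompact K) (hK_pos : K ⊆ Set.Ioi 0) (hK' : IsCompact K')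
    (n₁ n₂ : ℕ → ℕ) (hn₁ : ∀ n, n₁ n = ⌊(n : ℝ) * α⌋₊) (hn₂ : ∀ n, n₂ n = n - n₁ n) :
    Tendsto
      (fun n : ℕ => ⨆ s₀ ∈ K, ⨆ μ₀ ∈ {μ : Fin (n₂ n) → ℝ | ∀ i, μ i ∈ K'},
        ∫⁻ x, PartialMeans.tvDist (PartialMeans.posterior γ π x.1 x.2)
          (PartialMeans.limitLaw s₀ μ₀ x.1 x.2)
          ∂(PartialMeans.dataLaw (n₁ n) (n₂ n) s₀ μ₀))
      atTop (𝓝 0) ∧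
    ∀ r : ℕ → ℝ,
      Tendsto (fun n : ℕ => r n / (Real.log n / n) ^ (1 / 4 : ℝ)) atTop atTop →
      Tendsto
        (fun n : ℕ => ⨆ s₀ ∈ K, ⨆ μ₀ ∈ {μ : Fin (n₂ n) → ℝ | ∀ i, μ i ∈ K' ∧ r n ≤ |μ i|},
          ∫⁻ x, PartialMeans.tvDist (PartialMeans.posterior γ π x.1 x.2)
            (PartialMeans.truncGaussianLaw s₀ x.1)
            ∂(PartialMeans.dataLaw (n₁ n) (n₂ n) s₀ μ₀))
        atTop (𝓝 0) := by
  obtain ⟨κ, hκ, L, hL⟩ := PartialMeans.exists_bounds_of_isCompact hK hK_pos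
  obtain ⟨B, hB⟩ := hK'.isBounded.exists_norm_le
  set β := min α (1 - α) / 2 with hβ
  have hβ0 : 0 < β := by have := sub_pos.2 hα1; positivity
  have hβα : β < α := by linarith [min_le_left α (1 - α)]
  have hβα' : β ≤ 1 - α := by linarith [min_le_right α (1 - α)]
  have hsize : ∀ᶠ n : ℕ in atTop, 0 < n₂ n ∧
      β * n ≤ n₁ n ∧ n₁ n ≤ n ∧ β * n ≤ n₂ n ∧ n₂ n ≤ n := by
    filter_upwards [PartialMeans.eventually_le_floor_mul hβα, eventually_gt_atTop 0] with n hn hn0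
    have hn' : (0 : ℝ) < n := by exact_mod_cast hn0
    have hle : (n₁ n : ℝ) ≤ n * α := by rw [hn₁]; exact Nat.floor_le (by positivity)
    have hlen : n₁ n ≤ n := by
      have : (n₁ n : ℝ) ≤ n := by nlinarith
      exact_mod_cast this
    have h2 : β * n ≤ n₂ n := by
      rw [hn₂, Nat.cast_sub hlen]; nlinarith
    have h2' : (0 : ℝ) < n₂ n := lt_of_lt_of_le (by positivity) h2
    exact ⟨by exact_mod_cast h2', by rw [hn₁]; exact hn, hlen, h2, by rw [hn₂]; omega⟩
  constructor
  · refine PartialMeans.tendsto_nhds_zero_of_forall_ofReal fun ε hε => ?_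
    obtain ⟨R, -, M, -, h⟩ := PartialMeans.exists_eventually_lintegral_tvDist_le hγ_pos hπ_pos
      hγ_cont.continuousOn hπ_cont.continuousOn hγ_int hπ_int (L := L) (B := B) hβ0 hκ hε
    filter_upwards [h, hsize] with n hn ⟨hpos, h1, h2, h3, h4⟩
    refine iSup₂_le fun s₀ hs₀ => iSup₂_le fun μ₀ hμ₀ => ?_
    have hw : 0 < s₀ + PartialMeans.meanSq μ₀ :=
      add_pos_of_pos_of_nonneg (hK_pos hs₀) (PartialMeans.meanSq_nonneg μ₀)
    simp_rw [PartialMeans.limitLaw_eq_lawOfDensity hpos μ₀ hw]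
    refine hn _ _ h1 h2 h3 h4 s₀ (hL s₀ hs₀).1 (hL s₀ hs₀).2 μ₀ (fun i => hB _ (hμ₀ i)) _
      ?_ (fun p hp => ⟨hp.1.le, hp.2⟩) (fun a b s v _ _ _ _ hT => hT.2)
    exact (measurableSet_le measurable_const measurable_fst).inter
      (measurableSet_lt measurable_fst measurable_snd)
  · intro r hr
    refine PartialMeans.tendsto_nhds_zero_of_forall_ofReal fun ε hε => ?_
    obtain ⟨R, -, M, -, h⟩ := PartialMeans.exists_eventually_lintegral_tvDist_le hγ_pos hπ_pos
      hγ_cont.continuousOn hπ_cont.continuousOn hγ_int hπ_int (L := L) (B := B) hβ0 hκ hε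
    filter_upwards [h, hsize, PartialMeans.eventually_div_sqrt_lt_sq hr (2 * R + 2 * M)]
      with n hn ⟨hpos, h1, h2, h3, h4⟩ ⟨hr0, hrn⟩
    refine iSup₂_le fun s₀ hs₀ => iSup₂_le fun μ₀ hμ₀ => ?_
    have hw : 0 < s₀ + PartialMeans.meanSq μ₀ :=
      add_pos_of_pos_of_nonneg (hK_pos hs₀) (PartialMeans.meanSq_nonneg μ₀)
    have hgap := PartialMeans.le_meanSq hpos hr0.le fun i => (hμ₀ i).2
    have hlaw (x : (Fin (n₁ n) → ℝ) × (Fin (n₂ n) → ℝ)) :=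
      PartialMeans.truncGaussianLaw_eq_lawOfDensity (s₀ := s₀) hpos hw x.1
        (PartialMeans.meanSq x.2)
    simp_rw [hlaw]
    refine hn _ _ h1 h2 h3 h4 s₀ (hL s₀ hs₀).1 (hL s₀ hs₀).2 μ₀ (fun i => hB _ (hμ₀ i).1) _
      (measurableSet_le measurable_const measurable_fst) (fun p hp => hp.1.le) ?_
    -- In the window `s` stays near the lower peak and `v` near the upper one.
    intro a b s v ha hb hs hv _
    rw [abs_le] at ha hb hs hv
    rw [add_div, mul_div_assoc, mul_div_assoc] at hrn
    linarith [ha.2, hb.1, hs.2, hv.1]
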